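/- Let $n\ge 2$, $M\ge 1$, and let $\Sigma$ be the switched linear system $x(t+1)=A_{\sigma(t)}x(t)$, $y(t)=C_{\sigma(t)}x(t)$, with $x(t)\in\mathbb R^n$, $y(t)\in\mathbb R^p$ and $\sigma(t)\in\mathcal M=\{1,\dots,M\}$. For $\pmb\sigma\in\mathcal M^T$ and $x\in\mathbb R^n$ let $v$ and $z$ be the stacked first $k$ outputs $(y(0),\dots,y(k-1))$ and last $k$ outputs $(y(T-k),\dots,y(T-1))$ of the trajectory with $x(0)=x$ and switching sequence $\pmb\sigma$. Let $\gamma^o_k$ be the infimum of the $\gamma\ge 0$ for which some symmetric $P\succeq I$ satisfies $$z^\top P z\le\gamma^{2(T-k)}\,v^\top P v \qquad (*)$$ for all $(x,\pmb\sigma)\in\mathbb R^n\times\mathcal M^T$. For a sample $\omega_N=\{(x_0^i,\pmb\sigma^i)\}_{i=1}^N$ and $\bar\lambda\ge 1$ let $\gamma^*_k(\omega_N)$ be the minimal $\gamma\ge0$ for which some symmetric $P$ with $I\preceq P\preceq\bar\lambda I$ satisfies $(*)$ for the $N$ sampled trajectories. The samples are i.i.d., with $x_0^i$ uniform on the unit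 sphere of $\mathbb R^n$ and, independently, the $T$ modes in $\pmb\sigma^i$ i.i.d. uniform on $\mathcal M$; their law is $\mathbb P^N$. Assume that $\Sigma$ is pathwise observable with index at most $k$ (so that for every $\pmb\sigma\in\mathcal M^k$, vanishing of $y(0),\dots,y(k-1)$ forces $x(0)=0$), that $k\le T-1$, and that no $\pmb\sigma\in\mathcal M^T$ is degenerate, i.e. for no $\pmb\sigma$ are there $P\succ0$ and $\gamma\ge0$ with equality in $(*)$ for all $x\in\mathbb R^n$. For $\beta\in(0,1)$ and $\varepsilon\ge0$ let the sample complexity $N_s(\varepsilon,\beta)$ be the least $N$ with $\mathbb P^N\{\omega_N:\gamma^o_k\le(1+\varepsilon)\gamma^*_k(\omega_N)\}\ge1-\beta$ ($\infty$ if there is none). Let $$\mathcal I(x;a,b)=\frac{\int_0^x t^{a-1}(1-t)^{b-1}dt}{\int_0^1 t^{a-1}(1-t)^{b-1}dt},\qquad d=\frac{kp(kp+1)}2,\qquad \phi(\epsilon;d,N)=1-\mathcal I(\epsilon;d,N-d+1)\quad(N\ge d),$$ and let $\mathcal N_\phi(\epsilon,\beta)$ be the least $N\ge d$ with $\phi(\epsilon;d,N)\le\beta$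 ($\infty$ if there is none). Then: (i) There is a constant $c\ge1$, depending only on $\Sigma$ and $k$, such that for all $\beta\in(0,1)$ and $\varepsilon\ge0$ $$N_s(\varepsilon,\beta)\le\mathcal N_\phi\!\left(\frac{\mathcal I\big(1-\frac1{(1+\varepsilon)^{2(T-k)}};\frac{n-1}2,\frac12\big)}{M^T\sqrt{(c\bar\lambda)^{n-1}}},\ \beta\right),$$ and the right-hand side is $O\big(\frac1\beta(\frac1\varepsilon)^{n/2}\big)$: there is a constant $K>0$, independent of $\varepsilon$ and $\beta$, such that for all $\beta\in(0,1)$ and $\varepsilon\in(0,1]$ it is finite and at most $K\frac1\beta(\frac1\varepsilon)^{n/2}$. Consequently the scheme is PAC: for all such $\beta,\varepsilon$ and every $N\ge K\frac1\beta(\frac1\varepsilon)^{n/2}$, $\mathbb P^N\{\omega_N:\gamma^o_k\le(1+\varepsilon)\gamma^*_k(\omega_N)\}\ge1-\beta$. (ii) If the joint spectral radius $\rho(\Sigma)=\lim_{j\to\infty}\max_{\pmb\sigma\in\mathcal M^j}\|A_{\sigma_{j-1}}\cdots A_{\sigma_0}\|^{1/j}$ satisfies $\rho(\Sigma)>1$,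 then for all $\beta\in(0,1)$, $\varepsilon\ge0$ and every integer $N\ge N_s(\varepsilon,\beta)$, $$\mathbb P^N\Big\{\omega_N:\gamma^*_k(\omega_N)<\frac1{1+\varepsilon}\Big\}\le\beta .$$ -/

import Mathlib

open MeasureTheory ProbabilityTheory Filter Topology Matrix

/-- A discrete-time switched linear system `x(t+1) = A_{σ(t)} x(t)`, `y(t) = C_{σ(t)} x(t)` with
state dimension `n`, output dimension `p` and `M` modes. -/
structure SLS (n p M : ℕ) where
  /-- the dynamics matrices -/
  A : Fin M → Matrix (Fin n) (Fin n) ℝ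
  /-- the output matrices -/
  C : Fin M → Matrix (Fin p) (Fin n) ℝ

/-- The unit sphere of the Euclidean space `ℝⁿ`. -/
abbrev UnitSphere (n : ℕ) : Type := Metric.sphere (0 : EuclideanSpace ℝ (Fin n)) 1

/-- One random datum: an initial state on the unit sphere and a switching sequence of length `T`. -/
abbrev Datum (n M T : ℕ) : Type := UnitSphere n × (Fin T → Fin M)

namespace SLS

noncomputable section

variable {n p M : ℕ} (S : SLS n p M)

/-- `S.transition σ t = A_{σ(t-1)} ⋯ A_{σ(0)}`, for `t ≤ T`
(it is only used for such `t`; the product stops at the end of the word). -/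
def transition {T : ℕ} (σ : Fin T → Fin M) : ℕ → Matrix (Fin n) (Fin n) ℝ
  | 0 => 1
  | t + 1 => (if h : t < T then S.A (σ ⟨t, h⟩) else 1) * transition σ t

/-- The output `y(t)`, for `t < T`, from the initial state `x` (only used for such `t`). -/
def output {T : ℕ} (σ : Fin T → Fin M) (x : Fin n → ℝ) (t : ℕ) : Fin p → ℝ :=
  if h : t < T then S.C (σ ⟨t, h⟩) *ᵥ (S.transition σ t *ᵥ x) else 0

/-- The stacked outputs `(y(ℓ), …, y(ℓ+k-1))`, for `ℓ + k ≤ T`. -/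
def window {T : ℕ} (σ : Fin T → Fin M) (x : Fin n → ℝ) (ℓ k : ℕ) : Fin k × Fin p → ℝ :=
  fun ij => S.output σ x (ℓ + ij.1) ij.2

/-- A switching sequence is observable if zero output forces a zero initial state. -/
def Observable {k : ℕ} (σ : Fin k → Fin M) : Prop :=
  ∀ x : Fin n → ℝ, S.window σ x 0 k = 0 → x = 0

/-- The pathwise observability index: the least `k` such that all switching sequences of length
`k` are observable, and `⊤` if there is none. -/
def pathwiseIndex : ℕ∞ :=
  ⨅ (k : ℕ) (_ : ∀ σ : Fin k → Fin M, S.Observable σ), (k : ℕ∞)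

/-- The joint spectral radius `lim_k max_{σ ∈ M^k} ‖A_σ‖^{1/k}` (spectral norm). -/
def jsr : ℝ :=
  limUnder atTop fun k : ℕ =>
    ⨆ σ : Fin k → Fin M,
      ‖Matrix.toEuclideanCLM (𝕜 := ℝ) (S.transition σ k)‖ ^ (1 / (k : ℝ))

/-- A switching sequence of length `T` is degenerate (for the window length `k`). -/
def Degenerate (k : ℕ) {T : ℕ} (σ : Fin T → Fin M) : Prop :=
  ∃ (P : Matrix (Fin k × Fin p) (Fin k × Fin p) ℝ) (γ : ℝ), P.PosDef ∧ 0 ≤ γ ∧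
    ∀ x : Fin n → ℝ,
      S.window σ x (T - k) k ⬝ᵥ (P *ᵥ S.window σ x (T - k) k) =
        γ ^ (2 * (T - k)) * (S.window σ x 0 k ⬝ᵥ (P *ᵥ S.window σ x 0 k))

/-- The Lyapunov inequality `zᵀ P z ≤ γ^{2(T-k)} vᵀ P v` for the trajectory from `x` along `σ`,
where `v` and `z` are the first and the last `k` outputs. -/
def Decrease (k : ℕ) {T : ℕ} (γ : ℝ) (P : Matrix (Fin k × Fin p) (Fin k × Fin p) ℝ)
    (σ : Fin T → Fin M) (x : Fin n → ℝ) : Prop :=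
  S.window σ x (T - k) k ⬝ᵥ (P *ᵥ S.window σ x (T - k) k) ≤
    γ ^ (2 * (T - k)) * (S.window σ x 0 k ⬝ᵥ (P *ᵥ S.window σ x 0 k))

/-- Feasibility of `(γ, P)` in the robust program: all trajectories of length `T`, `P ⪰ I`. -/
def RobustFeasible (k T : ℕ) (γ : ℝ) (P : Matrix (Fin k × Fin p) (Fin k × Fin p) ℝ) : Prop :=
  0 ≤ γ ∧ (P - 1).PosSemidef ∧
    ∀ (σ : Fin T → Fin M) (x : Fin n → ℝ), S.Decrease k γ P σ x

/-- Feasibility of `(γ, P)` in the scenario program: the sampled trajectories, `I ⪯ P ⪯ lam I`. -/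
def ScenarioFeasible (k T : ℕ) (lam : ℝ) {N : ℕ} (ω : Fin N → Datum n M T) (γ : ℝ)
    (P : Matrix (Fin k × Fin p) (Fin k × Fin p) ℝ) : Prop :=
  0 ≤ γ ∧ (P - 1).PosSemidef ∧ (lam • 1 - P).PosSemidef ∧
    ∀ i : Fin N, S.Decrease k γ P (ω i).2 (WithLp.ofLp (ω i).1.1)

/-- The optimal `γ` of the robust program. -/
def gammaRobust (k T : ℕ) : ℝ := sInf {γ : ℝ | ∃ P, S.RobustFeasible k T γ P}

/-- The optimal `γ` of the scenario program, that is, the first component of its lexicographic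
solution (see `SLS.IsLexMin.eq_sInf`). -/
def gammaStar (k T : ℕ) (lam : ℝ) {N : ℕ} (ω : Fin N → Datum n M T) : ℝ :=
  sInf {γ : ℝ | ∃ P, S.ScenarioFeasible k T lam ω γ P}

/-- `(γ, P)` minimizes `(γ, ‖P‖_F)` lexicographically under the constraints `F`. -/
def IsLexMin {ι : Type*} [Fintype ι] (F : ℝ → Matrix ι ι ℝ → Prop) (γ : ℝ) (P : Matrix ι ι ℝ) :
    Prop :=
  F γ P ∧ ∀ γ' P', F γ' P' →
    γ < γ' ∨ (γ = γ' ∧ √(∑ i, ∑ j, P i j ^ 2) ≤ √(∑ i, ∑ j, P' i j ^ 2))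

theorem IsLexMin.eq_sInf {ι : Type*} [Fintype ι] {F : ℝ → Matrix ι ι ℝ → Prop} {γ : ℝ}
    {P : Matrix ι ι ℝ} (h : IsLexMin F γ P) : γ = sInf {γ' : ℝ | ∃ P', F γ' P'} := by
  have hl : IsLeast {γ' : ℝ | ∃ P', F γ' P'} γ := by
    refine ⟨⟨P, h.1⟩, ?_⟩
    rintro γ' ⟨P', hP'⟩
    rcases h.2 γ' P' hP' with h' | h'
    · exact h'.le
    · exact h'.1.le
  exact hl.csInf_eq.symm

end

end SLS

noncomputable section

/-- The uniform probability measure on the unit sphere: the normalized surface measure. -/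
def sphereUniform (n : ℕ) : Measure (UnitSphere n) :=
  (volume : Measure (EuclideanSpace ℝ (Fin n))).toSphere[|Set.univ]

/-- The law of one datum: uniform initial state, independent i.i.d. uniform modes. -/
def datumLaw (n M T : ℕ) : Measure (Datum n M T) :=
  (sphereUniform n).prod (Measure.pi fun _ : Fin T => uniformOn (Set.univ : Set (Fin M)))

/-- The law of a sample of `N` i.i.d. data. -/
def sampleLaw (n M T N : ℕ) : Measure (Fin N → Datum n M T) :=
  Measure.pi fun _ : Fin N => datumLaw n M T

/-- The sample complexity: the least `N` such that `γ° ≤ (1 + ε) γ*(ω_N)` with probability at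
least `1 - β`, and `⊤` if there is none. -/
def SLS.sampleComplexity {n p M : ℕ} (S : SLS n p M) (k T : ℕ) (lam ε β : ℝ) : ℕ∞ :=
  ⨅ (N : ℕ) (_ : ENNReal.ofReal (1 - β) ≤ sampleLaw n M T N
      {ω | S.gammaRobust k T ≤ (1 + ε) * S.gammaStar k T lam ω}), (N : ℕ∞)

/-- The regularized incomplete beta function `I(x; a, b)`. -/
def regBeta (x a b : ℝ) : ℝ :=
  (∫ t in (0 : ℝ)..x, t ^ (a - 1) * (1 - t) ^ (b - 1)) /
    ∫ t in (0 : ℝ)..1, t ^ (a - 1) * (1 - t) ^ (b - 1)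

/-- `φ(ϵ; d, N) = 1 - I(ϵ; d, N - d + 1)`, for `N ≥ d`. -/
def phiTail (e : ℝ) (d N : ℕ) : ℝ := 1 - regBeta e d ((N : ℝ) - d + 1)

/-- The least `N` (`≥ d`, so that `φ(ϵ; d, N)` makes sense) with `φ(ϵ; d, N) ≤ β`, and `⊤` if there
is none. -/
def nPhi (d : ℕ) (e β : ℝ) : ℕ∞ :=
  ⨅ (N : ℕ) (_ : d ≤ N ∧ phiTail e d N ≤ β), (N : ℕ∞)

/-- The level at which `nPhi` is evaluated to guarantee the relative precision `ε`:
`I(1 - (1+ε)^{-2(T-k)}; (n-1)/2, 1/2) / (M^T √((c lam)^{n-1}))`. -/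
def precisionLevel (n M k T : ℕ) (c lam ε : ℝ) : ℝ :=
  regBeta (1 - 1 / (1 + ε) ^ (2 * (T - k))) (((n : ℝ) - 1) / 2) (1 / 2) /
    ((M : ℝ) ^ T * √((c * lam) ^ (n - 1)))

end

/-! At a fixed level `γ` the inequality `(*)` is linear and homogeneous in `P`. Hence `P` can be
rescaled to `1 + X` with `X` symmetric and traceless, a space of dimension at most `d - 1`. Each
datum cuts out a closed convex set of such `X`, and `γ* < γ` forces the `N` sampled sets to have a
common point. Two facts are needed: a single datum excludes any given `X` with a definite
probability, and i.i.d. convex sets with this property rarely intersect.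

Exclusion (`exists_le_datumLaw_not_decrease`). For given `P`, let `ρ` be the maximal growth ratio of
the energy over the sphere and all words, attained at `(u, σ₀)`; then `γ° ^ (2(T-k)) ≤ ρ`. With `Q`,
`R` the energy forms of the first and last window along `σ₀`, the form `ρQ - R` is semidefinite and
vanishes at `u`, so it annihilates `u`, and along `su + w` the form `R` falls short of `ρQ` by at
most `ρ` times `Q(w)`. All states in a cone around `u` of slope proportional to `√(h/λ̄)`, `h = 1 -
(1+ε)^(-2(T-k))`, therefore violate `(*)` at the level `γ°/(1+ε)`. Such a cone has measure of order
`(h/λ̄)^((n-1)/2)`, which matches `I(h; (n-1)/2, 1/2)` up to a constant, and `σ₀` is drawn with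
probability `M^(-T)`.

Intersection (`feasible_le_max`). Helly's theorem and a leave-one-out argument with least-norm
points bound the probability of a common point of `N` sets by `d / ((N+1)v)`, where `v` is the
exclusion probability. This is at most `1/2` at a suitable `N₀`. Smaller samples are handled by
subsampling, larger ones by cutting into independent blocks. With `v ≥ 12de` the outcome is at most
`max (1 - C(N,d) e^d) ((1-e)^N)`. Both terms are below `φ(e; d, N)`, the probability of fewer than
`d` successes in `N` trials. The loss of `12d` goes into `c`. Markov's inequality for the Beta law
then gives the polynomial sample size.

Part (ii). If `γ° < 1`, a feasible `P` bounds all matrix products, so the joint spectral radius is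
at most one (`one_le_gammaRobust`). As `γ*` can only grow when data are added, the confidence
reached at `N_s` persists for larger samples. -/

/-- Selecting coordinates of an i.i.d. family along an injection gives an i.i.d. family. -/
theorem measurePreserving_pi_comp {ι κ Ω : Type*} [Fintype ι] [Fintype κ] [MeasurableSpace Ω]
    (μ : Measure Ω) [IsProbabilityMeasure μ] {f : κ → ι} (hf : Function.Injective f) :
    MeasurePreserving (fun ω : ι → Ω => ω ∘ f) (Measure.pi fun _ => μ) (Measure.pi fun _ => μ) := by
  have hm : Measurable (fun ω : ι → Ω => ω ∘ f) :=
    measurable_pi_lambda _ fun j => measurable_pi_apply (f j)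
  refine ⟨hm, (Measure.pi_eq fun s hs => ?_).symm⟩
  rw [Measure.map_apply hm (MeasurableSet.univ_pi hs)]
  have hpre : (fun ω : ι → Ω => ω ∘ f) ⁻¹' Set.univ.pi s =
      Set.univ.pi fun i => ⋂ j, ⋂ (_ : f j = i), s j := by
    ext ω
    simp only [Set.mem_preimage, Set.mem_pi, Set.mem_univ, true_imp_iff, Set.mem_iInter,
      Function.comp_apply]
    exact ⟨fun h i j hj => hj ▸ h j, fun h j => h (f j) j rfl⟩
  rw [hpre, Measure.pi_pi]
  refine (Fintype.prod_of_injective f hf _ _ (fun i hi => ?_) fun j => ?_).symm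
  · have : (⋂ j, ⋂ (_ : f j = i), s j) = Set.univ := by
      refine Set.iInter_eq_univ.2 fun j => Set.iInter_eq_univ.2 fun hj => (hi ⟨j, hj⟩).elim
    rw [this, measure_univ]
  · congr 1
    ext x
    simp only [Set.mem_iInter]
    exact ⟨fun h j' hj' => hf hj' ▸ h, fun h => h j rfl⟩

/-! ### Helly-type combinatorics of convex constraints -/

section RandomConvexSets

variable {Ω E ι : Type*}

/-- The samples for which the random sets indexed by `s` have a common point of norm at most `q`. -/
def boundedlyFeasible [Norm E] (C : Ω → Set E) (s : Finset ι) (q : ℝ) : Set (ι → Ω) :=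
  {ω | ∃ x, ‖x‖ ≤ q ∧ ∀ i ∈ s, x ∈ C (ω i)}

/-- The samples for which the random sets have a common point. -/
def feasibleSamples (C : Ω → Set E) (ι : Type*) : Set (ι → Ω) :=
  {ω | ∃ x, ∀ i, x ∈ C (ω i)}

/-- The norm bound makes the witness range over a compact ball, and projection along a compact
factor is a closed map. This is the source of measurability for all feasibility events. -/
theorem isClosed_boundedlyFeasible [NormedAddCommGroup E] [ProperSpace E] [TopologicalSpace Ω]
    {C : Ω → Set E} (hC : IsClosed {p : Ω × E | p.2 ∈ C p.1}) (s : Finset ι) (q : ℝ) :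
    IsClosed (boundedlyFeasible C s q) := by
  have hF : IsClosed {p : Metric.closedBall (0 : E) q × (ι → Ω) | ∀ i ∈ s, (p.1 : E) ∈ C (p.2 i)} := by
    simp only [Set.ofPred_forall]
    refine isClosed_iInter fun i => isClosed_iInter fun _ => ?_
    exact hC.preimage (f := fun p : Metric.closedBall (0 : E) q × (ι → Ω) => (p.2 i, (p.1 : E)))
      (by fun_prop)
  have : CompactSpace (Metric.closedBall (0 : E) q) :=
    isCompact_iff_compactSpace.1 (isCompact_closedBall 0 q)
  convert isClosedMap_snd_of_compactSpace _ hF using 1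
  ext ω
  constructor
  · rintro ⟨x, hx, h⟩
    exact ⟨(⟨x, by simpa using hx⟩, ω), h, rfl⟩
  · rintro ⟨⟨⟨x, hx⟩, ω'⟩, h, rfl⟩
    exact ⟨x, by simpa using hx, h⟩

theorem feasibleSamples_eq_iUnion [NormedAddCommGroup E] [Fintype ι] (C : Ω → Set E) :
    feasibleSamples C ι = ⋃ m : ℕ, boundedlyFeasible C (Finset.univ : Finset ι) m := by
  ext ω
  simp only [feasibleSamples, boundedlyFeasible, Set.mem_ofPred_eq, Set.mem_iUnion, Finset.mem_univ,
    true_imp_iff]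
  constructor
  · rintro ⟨x, hx⟩
    obtain ⟨m, hm⟩ := exists_nat_ge ‖x‖
    exact ⟨m, x, hm, hx⟩
  · rintro ⟨m, x, -, hx⟩
    exact ⟨x, hx⟩

/-- At most `dim E + 1` of finitely many convex sets are such that removing them lowers the
norm level at which the family becomes feasible. -/
theorem card_le_of_decreasing_level [NormedAddCommGroup E] [NormedSpace ℝ E]
    [FiniteDimensional ℝ E] [Fintype ι] [DecidableEq ι] {C : Ω → Set E}
    (hC : ∀ δ, Convex ℝ (C δ)) (ω : ι → Ω) (J : Finset ι)
    (hJ : ∀ i ∈ J, ∃ q : ℚ, ω ∈ boundedlyFeasible C (Finset.univ.erase i) q ∧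
      ω ∉ boundedlyFeasible C Finset.univ q) :
    J.card ≤ Module.finrank ℝ E + 1 := by
  by_contra! hcard
  choose! q hq using hJ
  have hne : J.Nonempty := Finset.card_pos.1 (by omega)
  -- Any `dim E + 1` of the sets miss some `j ∈ J`, hence meet within radius `q j ≤ q i₀`. Helly
  -- then makes the whole family feasible at `q i₀`, which the choice of `q i₀` forbids.
  obtain ⟨i₀, hi₀, hmax⟩ := J.exists_max_image q hne
  have key := Convex.helly_theorem' (𝕜 := ℝ) (F := fun i => Metric.closedBall 0 (q i₀ : ℝ) ∩ C (ω i))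
    (s := Finset.univ) (fun i _ => (convex_closedBall _ _).inter (hC _)) fun I _ hI => by
      obtain ⟨j, hj, hjI⟩ := Finset.exists_mem_notMem_of_card_lt_card (hI.trans_lt hcard)
      obtain ⟨x, hx, hxC⟩ := (hq j hj).1
      refine ⟨x, Set.mem_iInter₂.2 fun i hi => ⟨?_, hxC i ?_⟩⟩
      · have : (q j : ℝ) ≤ q i₀ := by exact_mod_cast hmax j hj
        simpa using hx.trans this
      · exact Finset.mem_erase.2 ⟨fun h => hjI (h ▸ hi), Finset.mem_univ _⟩
  obtain ⟨x, hx⟩ := key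
  rw [Set.mem_iInter₂] at hx
  exact (hq i₀ hi₀).2 ⟨x, by simpa using (hx i₀ (Finset.mem_univ _)).1, fun i _ => (hx i (Finset.mem_univ _)).2⟩

/-- An infeasible family of convex sets has an infeasible subfamily of `dim E + 1` members. -/
theorem exists_infeasible_subfamily [NormedAddCommGroup E] [NormedSpace ℝ E]
    [FiniteDimensional ℝ E] [Fintype ι] {C : Ω → Set E} (hC : ∀ δ, Convex ℝ (C δ)) {d : ℕ}
    (hd : Module.finrank ℝ E + 1 ≤ d) (hι : d ≤ Fintype.card ι) (ω : ι → Ω)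
    (hω : ω ∉ feasibleSamples C ι) :
    ∃ I : Finset ι, I.card = d ∧ ¬ ∃ x, ∀ i ∈ I, x ∈ C (ω i) := by
  by_contra! h
  apply hω
  have key := Convex.helly_theorem' (𝕜 := ℝ) (F := fun i => C (ω i))
    (s := Finset.univ) (fun i _ => hC _) fun I _ hI => by
      obtain ⟨I', hI', hc⟩ := Finset.exists_superset_card_eq (hI.trans hd) hι
      obtain ⟨x, hx⟩ := h I' hc
      exact ⟨x, Set.mem_iInter₂.2 fun i hi => hx i (hI' hi)⟩
  obtain ⟨x, hx⟩ := key
  exact ⟨x, fun i => Set.mem_iInter₂.1 hx i (Finset.mem_univ _)⟩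

end RandomConvexSets

/-! ### The leave-one-out bound on the probability of a common point -/

section RandomConvexSets

variable {Ω E ι : Type*}

section Measurability

variable [NormedAddCommGroup E] [ProperSpace E] [TopologicalSpace Ω] [MeasurableSpace Ω]
  [BorelSpace Ω] [SecondCountableTopology Ω] [Fintype ι]

theorem measurableSet_boundedlyFeasible {C : Ω → Set E} (hC : IsClosed {p : Ω × E | p.2 ∈ C p.1})
    (s : Finset ι) (q : ℝ) : MeasurableSet (boundedlyFeasible C s q) :=
  (isClosed_boundedlyFeasible hC s q).measurableSet

theorem measurableSet_feasibleSamples {C : Ω → Set E}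
    (hC : IsClosed {p : Ω × E | p.2 ∈ C p.1}) : MeasurableSet (feasibleSamples C ι) := by
  rw [feasibleSamples_eq_iUnion]
  exact MeasurableSet.iUnion fun m => measurableSet_boundedlyFeasible hC _ _

end Measurability

/-- If `x₀` has least norm in a convex set, then excluding `x₀` raises the norm level. -/
theorem exists_rat_norm_level [NormedAddCommGroup E] [InnerProductSpace ℝ E]
    [FiniteDimensional ℝ E] {K L : Set E} (hKc : Convex ℝ K) (hL : IsClosed L)
    (hLK : L ⊆ K) {x₀ : E} (hx₀ : x₀ ∈ K) (hmin : ∀ x ∈ K, ‖x₀‖ ≤ ‖x‖) (hx₀L : x₀ ∉ L) :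
    ∃ q : ℚ, ‖x₀‖ ≤ q ∧ ∀ x ∈ L, (q : ℝ) < ‖x‖ := by
  rcases L.eq_empty_or_nonempty with rfl | hne
  · obtain ⟨q, hq⟩ := exists_rat_gt ‖x₀‖
    exact ⟨q, hq.le, by simp⟩
  · obtain ⟨x₁, hx₁, hdist⟩ := hL.exists_infDist_eq_dist hne 0
    have hmin₁ : ∀ x ∈ L, ‖x₁‖ ≤ ‖x‖ := fun x hx => by
      have := Metric.infDist_le_dist_of_mem (x := (0 : E)) hx
      rw [hdist] at this
      simpa using this
    have hlt : ‖x₀‖ < ‖x₁‖ := by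
      refine lt_of_le_of_ne (hmin _ (hLK hx₁)) fun heq => ?_
      have hne' : x₀ ≠ x₁ := fun h => hx₀L (h ▸ hx₁)
      -- Two distinct points of least norm would have a midpoint of smaller norm, by strict
      -- convexity.
      have hmid : (1 / 2 : ℝ) • x₀ + (1 / 2 : ℝ) • x₁ ∈ K :=
        hKc hx₀ (hLK hx₁) (by norm_num) (by norm_num) (by norm_num)
      have := hmin _ hmid
      have hlt := norm_combo_lt_of_ne (le_refl ‖x₀‖) heq.ge hne' (a := 1 / 2) (b := 1 / 2)
        (by norm_num) (by norm_num) (by norm_num)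
      linarith
    obtain ⟨q, hq, hq'⟩ := exists_rat_btwn hlt
    exact ⟨q, hq.le, fun x hx => hq'.trans_le (hmin₁ x hx)⟩

variable [NormedAddCommGroup E] [InnerProductSpace ℝ E] [FiniteDimensional ℝ E]
  [TopologicalSpace Ω] [MeasurableSpace Ω] [BorelSpace Ω] [SecondCountableTopology Ω]
  (μ : Measure Ω) [IsProbabilityMeasure μ] {C : Ω → Set E}

/-- The samples for which removing the `i`-th set lowers the norm level of feasibility. -/
def levelDecreasing (C : Ω → Set E) {N : ℕ} (i : Fin N) : Set (Fin N → Ω) :=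
  ⋃ q : ℚ, boundedlyFeasible C (Finset.univ.erase i) (q : ℝ) \
    boundedlyFeasible C Finset.univ (q : ℝ)

/-- Condition on the `N` samples other than the `i`-th. If they are feasible, their least-norm
common point does not depend on the `i`-th sample, which excludes it with probability at least `e`;
the norm level then rises strictly. -/
theorem mul_feasible_le_levelDecreasing (hC : ∀ δ, Convex ℝ (C δ))
    (hCcl : IsClosed {p : Ω × E | p.2 ∈ C p.1}) {e : ENNReal}
    (he : ∀ x, e ≤ μ {δ | x ∉ C δ}) (N : ℕ) (i : Fin (N + 1)) :
    e * (Measure.pi fun _ : Fin N => μ) (feasibleSamples C (Fin N)) ≤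
      (Measure.pi fun _ : Fin (N + 1) => μ) (levelDecreasing C i) := by
  have hCδ : ∀ δ, IsClosed (C δ) := fun δ =>
    hCcl.preimage (f := fun x : E => (δ, x)) (by fun_prop)
  have hmeas : MeasurableSet (levelDecreasing C i) := MeasurableSet.iUnion fun q =>
    (measurableSet_boundedlyFeasible hCcl _ _).diff (measurableSet_boundedlyFeasible hCcl _ _)
  have hmp := (measurePreserving_piFinSuccAbove (fun _ : Fin (N + 1) => μ) i).symm
  rw [← hmp.measure_preimage hmeas.nullMeasurableSet,
    Measure.prod_apply_symm (hmp.measurable hmeas),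
    ← setLIntegral_const]
  refine (lintegral_mono_ae ?_).trans (setLIntegral_le_lintegral (feasibleSamples C (Fin N)) _)
  refine (ae_restrict_iff' (measurableSet_feasibleSamples hCcl)).2 (Eventually.of_forall fun ω hω => ?_)
  have hKc : Convex ℝ (⋂ j, C (ω j)) := convex_iInter fun j => hC _
  have hKcl : IsClosed (⋂ j, C (ω j)) := isClosed_iInter fun j => hCδ _
  have hKne : (⋂ j, C (ω j)).Nonempty := by
    obtain ⟨x, hx⟩ := hω
    exact ⟨x, Set.mem_iInter.2 hx⟩
  obtain ⟨x₀, hx₀, hdist⟩ := hKcl.exists_infDist_eq_dist hKne 0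
  have hmin : ∀ x ∈ ⋂ j, C (ω j), ‖x₀‖ ≤ ‖x‖ := fun x hx => by
    have := Metric.infDist_le_dist_of_mem (x := (0 : E)) hx
    rw [hdist] at this
    simpa using this
  refine (he x₀).trans (measure_mono fun δ hδ => ?_)
  obtain ⟨q, hq, hq'⟩ := exists_rat_norm_level hKc (hKcl.inter (hCδ δ))
    Set.inter_subset_left hx₀ hmin fun h => hδ h.2
  refine Set.mem_iUnion.2 ⟨q, ⟨x₀, hq, fun j hj => ?_⟩, ?_⟩
  · obtain ⟨l, rfl⟩ := Fin.exists_succAbove_eq (Finset.ne_of_mem_erase hj)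
    simpa [MeasurableEquiv.piFinSuccAbove, Fin.insertNthEquiv] using Set.mem_iInter.1 hx₀ l
  · rintro ⟨x, hx, hxC⟩
    refine (hq' x ⟨Set.mem_iInter.2 fun l => ?_, ?_⟩).not_ge hx
    · simpa [MeasurableEquiv.piFinSuccAbove, Fin.insertNthEquiv] using hxC (i.succAbove l) (Finset.mem_univ _)
    · simpa [MeasurableEquiv.piFinSuccAbove, Fin.insertNthEquiv] using hxC i (Finset.mem_univ _)

/-- Sum the preceding bound over `i`: by `card_le_of_decreasing_level` at most `dim E + 1` of these
events occur at once. -/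
theorem succ_mul_feasible_le (hC : ∀ δ, Convex ℝ (C δ))
    (hCcl : IsClosed {p : Ω × E | p.2 ∈ C p.1}) {e : ENNReal}
    (he : ∀ x, e ≤ μ {δ | x ∉ C δ}) (N : ℕ) :
    (N + 1 : ℕ) * (e * (Measure.pi fun _ : Fin N => μ) (feasibleSamples C (Fin N))) ≤
      (Module.finrank ℝ E + 1 : ℕ) := by
  classical
  have hmeas : ∀ i : Fin (N + 1), MeasurableSet (levelDecreasing C i) := fun i =>
    MeasurableSet.iUnion fun q =>
      (measurableSet_boundedlyFeasible hCcl _ _).diff (measurableSet_boundedlyFeasible hCcl _ _)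
  calc _ = ∑ i : Fin (N + 1),
        e * (Measure.pi fun _ : Fin N => μ) (feasibleSamples C (Fin N)) := by simp
    _ ≤ ∑ i : Fin (N + 1), (Measure.pi fun _ : Fin (N + 1) => μ) (levelDecreasing C i) :=
        Finset.sum_le_sum fun i _ => mul_feasible_le_levelDecreasing μ hC hCcl he N i
    _ = ∫⁻ ω, ∑ i : Fin (N + 1), (levelDecreasing C i).indicator 1 ω
          ∂(Measure.pi fun _ : Fin (N + 1) => μ) := by
        rw [lintegral_finsetSum _ fun i _ => measurable_one.indicator (hmeas i)]
        simp_rw [lintegral_indicator_one (hmeas _)]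
    _ ≤ ∫⁻ ω, (Module.finrank ℝ E + 1 : ℕ) ∂(Measure.pi fun _ : Fin (N + 1) => μ) := by
        refine lintegral_mono fun ω => ?_
        have : ∑ i : Fin (N + 1), (levelDecreasing C i).indicator (1 : (Fin (N + 1) → Ω) → ENNReal) ω =
            ((Finset.univ.filter fun i => ω ∈ levelDecreasing C i).card : ENNReal) := by
          simp [Set.indicator_apply]
        rw [this]
        refine Nat.cast_le.2 (card_le_of_decreasing_level hC ω _ fun i hi => ?_)
        simpa [levelDecreasing] using (Finset.mem_filter.1 hi).2
    _ = _ := by simp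

end RandomConvexSets

/-- Supersets of `I` arise injectively by adjoining subsets of its complement. -/
theorem card_supersets_of_card {ι : Type*} [Fintype ι] [DecidableEq ι] (I : Finset ι) {N : ℕ}
    (hN : I.card ≤ N) :
    (Fintype.card ι - I.card).choose (N - I.card) ≤
      ((Finset.univ.powersetCard N).filter fun J : Finset ι => I ⊆ J).card := by
  rw [← Finset.card_compl, ← Finset.card_powersetCard]
  refine Finset.card_le_card_of_injOn (fun J => I ∪ J) (fun J hJ => ?_) fun J hJ J' hJ' h => ?_
  · have hJ := Finset.mem_powersetCard.1 hJ
    have hdisj : Disjoint I J := (Finset.disjoint_left.2 fun i hi hiJ =>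
      (Finset.mem_compl.1 (hJ.1 hiJ)) hi)
    simp only [Finset.coe_filter, Set.mem_ofPred_eq, Finset.mem_powersetCard, Finset.subset_univ,
      true_and, Finset.subset_union_left, and_true]
    rw [Finset.card_union_of_disjoint hdisj, hJ.2]
    omega
  · have key : ∀ J ∈ (Finset.powersetCard (N - I.card) Iᶜ : Finset (Finset ι)), (I ∪ J) \ I = J :=
      fun J hJ => by
        have hJ := Finset.mem_powersetCard.1 hJ
        ext i
        simp only [Finset.mem_sdiff, Finset.mem_union]
        refine ⟨fun hi => hi.1.resolve_left hi.2, fun hi => ⟨Or.inr hi, ?_⟩⟩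
        exact Finset.mem_compl.1 (hJ.1 hi)
    rw [← key J hJ, ← key J' hJ']
    exact congrArg (· \ I) h

/-! ### Subsampling, independent blocks, and the final feasibility bound -/

section RandomConvexSets

variable {Ω E : Type*} [NormedAddCommGroup E] [InnerProductSpace ℝ E] [FiniteDimensional ℝ E]
  [TopologicalSpace Ω] [MeasurableSpace Ω] [BorelSpace Ω] [SecondCountableTopology Ω]
  (μ : Measure Ω) [IsProbabilityMeasure μ] {C : Ω → Set E}

/-- A common point of all sets serves both blocks, and the blocks are independent. -/
theorem feasible_add_le (hCcl : IsClosed {p : Ω × E | p.2 ∈ C p.1}) (a b : ℕ) :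
    (Measure.pi fun _ : Fin (a + b) => μ).real (feasibleSamples C (Fin (a + b))) ≤
      (Measure.pi fun _ : Fin a => μ).real (feasibleSamples C (Fin a)) *
        (Measure.pi fun _ : Fin b => μ).real (feasibleSamples C (Fin b)) := by
  have h₁ := measurePreserving_pi_comp μ (finSumFinEquiv (m := a) (n := b)).injective
  have h₂ := measurePreserving_sumPiEquivProdPi (fun _ : Fin a ⊕ Fin b => μ)
  have h := h₂.comp h₁
  rw [← measureReal_prod_prod, ← h.measureReal_preimage
    ((measurableSet_feasibleSamples hCcl).prod (measurableSet_feasibleSamples hCcl)).nullMeasurableSet]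
  refine measureReal_mono ?_
  rintro ω ⟨x, hx⟩
  exact ⟨⟨x, fun i => hx _⟩, ⟨x, fun i => hx _⟩⟩

theorem feasible_antitone (hCcl : IsClosed {p : Ω × E | p.2 ∈ C p.1}) {a b : ℕ} (hab : a ≤ b) :
    (Measure.pi fun _ : Fin b => μ).real (feasibleSamples C (Fin b)) ≤
      (Measure.pi fun _ : Fin a => μ).real (feasibleSamples C (Fin a)) := by
  obtain ⟨c, rfl⟩ := Nat.exists_eq_add_of_le hab
  exact (feasible_add_le μ hCcl a c).trans (mul_le_of_le_one_right measureReal_nonneg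
    measureReal_le_one)

theorem feasible_mul_le_pow (hCcl : IsClosed {p : Ω × E | p.2 ∈ C p.1}) (a m : ℕ) :
    (Measure.pi fun _ : Fin (m * a) => μ).real (feasibleSamples C (Fin (m * a))) ≤
      (Measure.pi fun _ : Fin a => μ).real (feasibleSamples C (Fin a)) ^ m := by
  induction m with
  | zero => simp
  | succ m ih =>
    rw [Nat.succ_mul, pow_succ]
    exact (feasible_add_le μ hCcl _ _).trans
      (mul_le_mul_of_nonneg_right ih measureReal_nonneg)

/-- Infeasibility of a sample of size `N₀` is inherited by a proportion of its subsamples. -/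
theorem choose_mul_infeasible_le (hC : ∀ δ, Convex ℝ (C δ))
    (hCcl : IsClosed {p : Ω × E | p.2 ∈ C p.1}) {d N N₀ : ℕ} (hd : Module.finrank ℝ E + 1 ≤ d)
    (hdN : d ≤ N) (hN : N ≤ N₀) :
    (N.choose d : ℝ) * (Measure.pi fun _ : Fin N₀ => μ).real (feasibleSamples C (Fin N₀))ᶜ ≤
      N₀.choose d * (Measure.pi fun _ : Fin N => μ).real (feasibleSamples C (Fin N))ᶜ := by
  classical
  have hmeas : ∀ n, MeasurableSet (feasibleSamples C (Fin n))ᶜ := fun n =>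
    (measurableSet_feasibleSamples hCcl).compl
  set B : Finset (Fin N₀) → Set (Fin N₀ → Ω) := fun J => {ω | ¬ ∃ x, ∀ i ∈ J, x ∈ C (ω i)} with hB
  have hBJ : ∀ J ∈ (Finset.univ : Finset (Fin N₀)).powersetCard N, MeasurableSet (B J) ∧
      (Measure.pi fun _ : Fin N₀ => μ).real (B J) =
        (Measure.pi fun _ : Fin N => μ).real (feasibleSamples C (Fin N))ᶜ := fun J hJ => by
    have hc := (Finset.mem_powersetCard.1 hJ).2
    have hmp := measurePreserving_pi_comp μ (J.orderEmbOfFin hc).injective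
    have : B J = (fun ω : Fin N₀ → Ω => ω ∘ J.orderEmbOfFin hc) ⁻¹' (feasibleSamples C (Fin N))ᶜ := by
      ext ω
      simp only [hB, feasibleSamples, Set.mem_preimage, Set.mem_compl_iff, Set.mem_ofPred_eq,
        Function.comp_apply]
      refine not_congr (exists_congr fun x => ⟨fun h i => h _ (J.orderEmbOfFin_mem hc i), fun h i hi => ?_⟩)
      have : i ∈ Set.range (J.orderEmbOfFin hc) := by rwa [Finset.range_orderEmbOfFin]
      obtain ⟨j, rfl⟩ := this
      exact h j
    rw [this]
    exact ⟨hmp.measurable (hmeas N), hmp.measureReal_preimage (hmeas N).nullMeasurableSet⟩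
  -- Double counting: an infeasible sample of size `N₀` contains an infeasible `d`-subset, and each
  -- of the `C(N₀ - d, N - d)` or more `N`-subsets containing it is infeasible as well.
  have hsum : ((N₀ - d).choose (N - d) : ℝ) *
      (Measure.pi fun _ : Fin N₀ => μ).real (feasibleSamples C (Fin N₀))ᶜ ≤
      N₀.choose N * (Measure.pi fun _ : Fin N => μ).real (feasibleSamples C (Fin N))ᶜ := by
    calc _ = ∫ ω, (feasibleSamples C (Fin N₀))ᶜ.indicator (fun _ => ((N₀ - d).choose (N - d) : ℝ)) ω
          ∂(Measure.pi fun _ : Fin N₀ => μ) := by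
          rw [integral_indicator_const _ (hmeas N₀), smul_eq_mul, mul_comm]
      _ ≤ ∫ ω, ∑ J ∈ (Finset.univ : Finset (Fin N₀)).powersetCard N,
            (B J).indicator (fun _ => (1 : ℝ)) ω ∂(Measure.pi fun _ : Fin N₀ => μ) := by
          refine integral_mono ((integrable_const _).indicator (hmeas N₀))
            (integrable_finsetSum _ fun J hJ => (integrable_const _).indicator (hBJ J hJ).1)
            fun ω => ?_
          by_cases hω : ω ∈ feasibleSamples C (Fin N₀)
          · simp only [Set.indicator_of_notMem (Set.notMem_compl_iff.2 hω)]
            exact Finset.sum_nonneg fun J _ => Set.indicator_nonneg (fun _ _ => zero_le_one) _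
          · rw [Set.indicator_of_mem hω]
            obtain ⟨I, hI, hIx⟩ := exists_infeasible_subfamily hC hd (by simpa using hdN.trans hN) ω hω
            have hcard := card_supersets_of_card I (hI.le.trans hdN)
            rw [hI, Fintype.card_fin] at hcard
            calc ((N₀ - d).choose (N - d) : ℝ) ≤
                (((Finset.univ : Finset (Fin N₀)).powersetCard N).filter fun J => I ⊆ J).card := by
                  exact_mod_cast hcard
              _ = ∑ J ∈ ((Finset.univ : Finset (Fin N₀)).powersetCard N).filter fun J => I ⊆ J,
                    (B J).indicator (fun _ => (1 : ℝ)) ω := by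
                  rw [Finset.card_eq_sum_ones, Nat.cast_sum]
                  refine Finset.sum_congr rfl fun J hJ => ?_
                  rw [Set.indicator_of_mem, Nat.cast_one]
                  rintro ⟨x, hx⟩
                  exact hIx ⟨x, fun i hi => hx i ((Finset.mem_filter.1 hJ).2 hi)⟩
              _ ≤ _ := Finset.sum_le_sum_of_subset_of_nonneg (Finset.filter_subset _ _)
                  fun J _ _ => Set.indicator_nonneg (fun _ _ => zero_le_one) _
      _ = ∑ J ∈ (Finset.univ : Finset (Fin N₀)).powersetCard N,
            (Measure.pi fun _ : Fin N₀ => μ).real (B J) := by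
          rw [integral_finsetSum _ fun J hJ => (integrable_const _).indicator (hBJ J hJ).1]
          refine Finset.sum_congr rfl fun J hJ => ?_
          rw [integral_indicator_const _ (hBJ J hJ).1, smul_eq_mul, mul_one]
      _ = _ := by
          rw [Finset.sum_congr rfl fun J hJ => (hBJ J hJ).2]
          simp
  have hchoose : (N₀.choose N : ℝ) * N.choose d = N₀.choose d * (N₀ - d).choose (N - d) := by
    exact_mod_cast Nat.choose_mul (n := N₀) hdN
  have hpos : (0 : ℝ) < N₀.choose N := by exact_mod_cast Nat.choose_pos hN
  refine le_of_mul_le_mul_left ?_ hpos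
  rw [← mul_assoc, hchoose, mul_assoc]
  calc _ ≤ (N₀.choose d : ℝ) * _ := mul_le_mul_of_nonneg_left hsum (Nat.cast_nonneg _)
    _ = _ := by ring

/-- **Feasibility of random convex constraints.** If every point of a `(d - 1)`-dimensional space is
excluded by a random closed convex set with probability at least `12 d e`, then the probability
that `N` independent copies have a common point is bounded by that of fewer than `d` successes
in `N` trials, up to the given elementary bounds. -/
theorem feasible_le_max (hC : ∀ δ, Convex ℝ (C δ))
    (hCcl : IsClosed {p : Ω × E | p.2 ∈ C p.1}) {d N : ℕ} (hd : Module.finrank ℝ E + 1 ≤ d)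
    (hdN : d ≤ N) {e : ℝ} (he : 0 < e) (hex : ∀ x, 12 * d * e ≤ μ.real {δ | x ∉ C δ}) :
    (Measure.pi fun _ : Fin N => μ).real (feasibleSamples C (Fin N)) ≤
      max (1 - N.choose d * e ^ d) ((1 - e) ^ N) := by
  have hd1 : (1 : ℝ) ≤ d := by exact_mod_cast (Nat.le_add_left 1 _).trans hd
  set E₀ : ℝ := 12 * d * e with hE₀
  have hE₀pos : 0 < E₀ := by positivity
  have hE₀le : E₀ ≤ 1 := (hex 0).trans measureReal_le_one
  -- The lower bound `2d ≤ N₀ E₀` makes `N₀` samples feasible with probability at most `1/2`; the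
  -- upper bound `N₀ ≤ 3d / E₀ = 1 / (4e)` is what the factor 12 is for.
  set N₀ : ℕ := ⌈2 * d / E₀⌉₊ with hN₀
  have hN₀ge : 2 * d / E₀ ≤ (N₀ : ℝ) := Nat.le_ceil _
  have hN₀le : (N₀ : ℝ) ≤ 3 * d / E₀ := by
    have h1 := (Nat.ceil_lt_add_one (a := 2 * d / E₀) (by positivity)).le
    have h2 : 1 ≤ d / E₀ := (one_le_div hE₀pos).2 (hE₀le.trans hd1)
    calc (N₀ : ℝ) ≤ 2 * d / E₀ + d / E₀ := by linarith
      _ = 3 * d / E₀ := by ring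
  have hN₀e : (N₀ : ℝ) * e ≤ 1 / 4 := by
    calc (N₀ : ℝ) * e ≤ 3 * d / E₀ * e := by gcongr
      _ = 1 / 4 := by rw [hE₀]; field_simp; norm_num
  have hN₀pos : (0 : ℝ) < N₀ := lt_of_lt_of_le (by positivity) hN₀ge
  have hhalf : (Measure.pi fun _ : Fin N₀ => μ).real (feasibleSamples C (Fin N₀)) ≤ 1 / 2 := by
    have h := succ_mul_feasible_le μ hC hCcl (e := ENNReal.ofReal E₀) (fun x => by
      rw [ENNReal.ofReal_le_iff_le_toReal (measure_ne_top _ _)]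
      exact hex x) N₀
    have h := ENNReal.toReal_mono (ENNReal.natCast_ne_top _) h
    rw [ENNReal.toReal_mul, ENNReal.toReal_mul, ENNReal.toReal_ofReal hE₀pos.le,
      ENNReal.toReal_natCast, ENNReal.toReal_natCast] at h
    change ((N₀ + 1 : ℕ) : ℝ) * (E₀ * (Measure.pi fun _ : Fin N₀ => μ).real (feasibleSamples C (Fin N₀))) ≤ _ at h
    have hd' : ((Module.finrank ℝ E + 1 : ℕ) : ℝ) ≤ d := by exact_mod_cast hd
    set f := (Measure.pi fun _ : Fin N₀ => μ).real (feasibleSamples C (Fin N₀))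
    have hf : 0 ≤ f := measureReal_nonneg
    have h2 : 2 * d ≤ N₀ * E₀ := (div_le_iff₀ hE₀pos).1 hN₀ge
    push_cast at h hd'
    have h3 : 2 * d * f ≤ d := by
      calc 2 * d * f ≤ N₀ * E₀ * f := by gcongr
        _ ≤ (N₀ + 1) * (E₀ * f) := by nlinarith [mul_nonneg hE₀pos.le hf]
        _ ≤ d := h.trans hd'
    have h4 : (d : ℝ) * (2 * f) ≤ d * 1 := by linarith
    have := le_of_mul_le_mul_left h4 (by linarith)
    linarith
  rcases le_total N N₀ with hN | hN
  · refine le_max_of_le_left ?_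
    -- Here `C(N₀,d) e^d ≤ (N₀ e)^d ≤ 1/2` is at most the infeasibility probability at `N₀`, so
    -- subsampling leaves infeasibility at least `C(N,d) e^d`.
    have h := choose_mul_infeasible_le μ hC hCcl hd hdN hN
    rw [probReal_compl_eq_one_sub (measurableSet_feasibleSamples hCcl),
      probReal_compl_eq_one_sub (measurableSet_feasibleSamples hCcl)] at h
    have hN₀d : (N₀.choose d : ℝ) * e ^ d ≤ 1 / 2 := by
      calc (N₀.choose d : ℝ) * e ^ d ≤ (N₀ : ℝ) ^ d * e ^ d := by
            gcongr
            exact_mod_cast Nat.choose_le_pow N₀ d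
        _ = (N₀ * e) ^ d := by rw [mul_pow]
        _ ≤ (1 / 4) ^ d := by gcongr
        _ ≤ (1 / 4) ^ 1 := pow_le_pow_of_le_one (by norm_num) (by norm_num)
            (by exact_mod_cast hd1)
        _ ≤ 1 / 2 := by norm_num
    have hcpos : (0 : ℝ) < N₀.choose d := by exact_mod_cast Nat.choose_pos (hdN.trans hN)
    have hNc : (0 : ℝ) ≤ N.choose d := Nat.cast_nonneg _
    set f := (Measure.pi fun _ : Fin N => μ).real (feasibleSamples C (Fin N))
    set f₀ := (Measure.pi fun _ : Fin N₀ => μ).real (feasibleSamples C (Fin N₀))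
    have : (N₀.choose d : ℝ) * (N.choose d * e ^ d) ≤ N₀.choose d * (1 - f) := by
      calc _ = (N.choose d : ℝ) * (N₀.choose d * e ^ d) := by ring
        _ ≤ N.choose d * (1 - f₀) := by gcongr; linarith
        _ ≤ _ := h
    linarith [le_of_mul_le_mul_left this hcpos]
  · refine le_max_of_le_right ?_
    have hN₀' : 0 < N₀ := by exact_mod_cast hN₀pos
    set m := N / N₀ with hm
    have hm1 : 1 ≤ m := (Nat.one_le_div_iff hN₀').2 hN
    have hle : m * N₀ ≤ N := Nat.div_mul_le_self N N₀
    -- From `N < (m + 1) N₀` and `m ≥ 1`. By Bernoulli each factor `1/2` per block is at most `(1 -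
    -- e)^(2 N₀)`, so `m` blocks suffice for `(1 - e)^N`.
    have hge : N ≤ 2 * N₀ * m := by
      have := Nat.lt_div_mul_add (a := N) hN₀'
      rw [← hm] at this
      nlinarith
    have he1 : e ≤ 1 := by
      have : (1 : ℝ) ≤ 12 * d := by linarith
      nlinarith
    have hbern : 1 / 2 ≤ (1 - e) ^ (2 * N₀) := by
      have := one_add_mul_le_pow (a := -e) (by linarith) (2 * N₀)
      push_cast at this
      rw [← sub_eq_add_neg] at this
      linarith
    calc _ ≤ (Measure.pi fun _ : Fin (m * N₀) => μ).real (feasibleSamples C (Fin (m * N₀))) :=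
          feasible_antitone μ hCcl hle
      _ ≤ _ := feasible_mul_le_pow μ hCcl _ _
      _ ≤ (1 / 2) ^ m := by gcongr
      _ ≤ ((1 - e) ^ (2 * N₀)) ^ m := by gcongr
      _ = (1 - e) ^ (2 * N₀ * m) := (pow_mul _ _ _).symm
      _ ≤ (1 - e) ^ N := pow_le_pow_of_le_one (by linarith) (by linarith) hge

end RandomConvexSets

/-! ### Estimates for the incomplete beta function and for `phiTail` -/

section BetaFunction

theorem betaIntegrand_eqOn (a b : ℝ) :
    Set.EqOn (fun t : ℝ => (t : ℂ) ^ ((a : ℂ) - 1) * (1 - (t : ℂ)) ^ ((b : ℂ) - 1))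
      (fun t : ℝ => ((t ^ (a - 1) * (1 - t) ^ (b - 1) : ℝ) : ℂ)) (Set.Ioc 0 1) := fun t ht => by
  have h1 : (0 : ℝ) ≤ 1 - t := by linarith [ht.2]
  simp only [Complex.ofReal_mul]
  rw [Complex.ofReal_cpow ht.1.le, Complex.ofReal_cpow h1]
  push_cast
  rfl

theorem intervalIntegrable_beta {a b : ℝ} (ha : 0 < a) (hb : 0 < b) :
    IntervalIntegrable (fun t : ℝ => t ^ (a - 1) * (1 - t) ^ (b - 1)) volume 0 1 := by
  have h := Complex.betaIntegral_convergent (u := a) (v := b) (by simpa) (by simpa)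
  rw [intervalIntegrable_iff, Set.uIoc_of_le zero_le_one] at h ⊢
  have h' := (h.congr_fun (betaIntegrand_eqOn a b) measurableSet_Ioc).re
  simpa [IntegrableOn] using h'

theorem integral_beta {a b : ℝ} (ha : 0 < a) (hb : 0 < b) :
    ∫ t in (0 : ℝ)..1, t ^ (a - 1) * (1 - t) ^ (b - 1) = beta a b := by
  rw [beta_eq_betaIntegralReal a b ha hb, Complex.betaIntegral,
    intervalIntegral.integral_of_le zero_le_one, intervalIntegral.integral_of_le zero_le_one,
    setIntegral_congr_fun measurableSet_Ioc (betaIntegrand_eqOn a b), integral_complex_ofReal,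
    Complex.ofReal_re]

theorem beta_add_one {a b : ℝ} (ha : 0 < a) (hb : 0 < b) :
    beta (a + 1) b = a / (a + b) * beta a b := by
  have h1 := (Real.Gamma_pos_of_pos (add_pos ha hb)).ne'
  have h2 : a + b ≠ 0 := (add_pos ha hb).ne'
  rw [beta, beta, Real.Gamma_add_one ha.ne', show a + 1 + b = a + b + 1 by ring,
    Real.Gamma_add_one h2]
  field_simp

theorem betaIntegrand_nonneg {a b t : ℝ} (ht : t ∈ Set.Icc (0 : ℝ) 1) :
    0 ≤ t ^ (a - 1) * (1 - t) ^ (b - 1) :=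
  mul_nonneg (Real.rpow_nonneg ht.1 _) (Real.rpow_nonneg (by linarith [ht.2]) _)

theorem regBeta_nonneg {x a b : ℝ} (ha : 0 < a) (hb : 0 < b) (hx : x ∈ Set.Icc (0 : ℝ) 1) :
    0 ≤ regBeta x a b := by
  rw [regBeta, integral_beta ha hb]
  exact div_nonneg (intervalIntegral.integral_nonneg hx.1 fun t ht =>
    betaIntegrand_nonneg ⟨ht.1, ht.2.trans hx.2⟩) (beta_pos ha hb).le

theorem one_sub_regBeta {x a b : ℝ} (ha : 0 < a) (hb : 0 < b) (hx : x ∈ Set.Icc (0 : ℝ) 1) :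
    1 - regBeta x a b = (∫ t in x..1, t ^ (a - 1) * (1 - t) ^ (b - 1)) / beta a b := by
  have h := intervalIntegrable_beta ha hb
  have h0 := h.mono_set (Set.uIcc_subset_uIcc_left (by rwa [Set.uIcc_of_le zero_le_one] : x ∈ Set.uIcc (0 : ℝ) 1))
  have h1 := h.mono_set (Set.uIcc_subset_uIcc_right (by rwa [Set.uIcc_of_le zero_le_one] : x ∈ Set.uIcc (0 : ℝ) 1))
  have hB := (beta_pos ha hb).ne'
  rw [regBeta, integral_beta ha hb, eq_div_iff hB, sub_mul, div_mul_cancel₀ _ hB, one_mul,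
    ← integral_beta ha hb, ← intervalIntegral.integral_add_adjacent_intervals h0 h1,
    add_sub_cancel_left]

theorem regBeta_le_one {x a b : ℝ} (ha : 0 < a) (hb : 0 < b) (hx : x ∈ Set.Icc (0 : ℝ) 1) :
    regBeta x a b ≤ 1 := by
  rw [← sub_nonneg, one_sub_regBeta ha hb hx]
  exact div_nonneg (intervalIntegral.integral_nonneg hx.2 fun t ht =>
    betaIntegrand_nonneg ⟨hx.1.trans ht.1, ht.2⟩) (beta_pos ha hb).le

/-- The factor `(1 - t)^(-1/2)` is at least one, so it can be dropped from the integrand. -/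
theorem exists_le_regBeta {a : ℝ} (ha : 0 < a) :
    ∃ c : ℝ, 0 < c ∧ ∀ x ∈ Set.Icc (0 : ℝ) 1, c * x ^ a ≤ regBeta x a (1 / 2) := by
  have hB := beta_pos ha (one_half_pos (α := ℝ))
  refine ⟨(a * beta a (1 / 2))⁻¹, by positivity, fun x hx => ?_⟩
  have h := intervalIntegrable_beta ha (one_half_pos (α := ℝ))
  have h0 := h.mono_set (Set.uIcc_subset_uIcc_left (by rwa [Set.uIcc_of_le zero_le_one] : x ∈ Set.uIcc (0 : ℝ) 1))
  have hint : ∫ t in (0 : ℝ)..x, t ^ (a - 1) = x ^ a / a := by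
    rw [integral_rpow (Or.inl (by linarith))]
    simp [Real.zero_rpow ha.ne']
  rw [regBeta, integral_beta ha one_half_pos, le_div_iff₀ hB]
  calc (a * beta a (1 / 2))⁻¹ * x ^ a * beta a (1 / 2) = x ^ a / a := by field_simp
    _ = ∫ t in (0 : ℝ)..x, t ^ (a - 1) := hint.symm
    _ ≤ _ := by
      refine intervalIntegral.integral_mono_on_of_le_Ioo hx.1
        (intervalIntegral.intervalIntegrable_rpow' (by linarith)) h0 fun t ht => ?_
      have h1 : 1 ≤ (1 - t) ^ ((1 : ℝ) / 2 - 1) :=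
        Real.one_le_rpow_of_pos_of_le_one_of_nonpos (by linarith [ht.2, hx.2]) (by linarith [ht.1])
          (by norm_num)
      exact le_mul_of_one_le_right (Real.rpow_nonneg ht.1.le _) h1

/-- For `x ≤ 1/2` the factor `(1 - t)^(-1/2)` is at most 2; for `x ≥ 1/2` the trivial bound `1 ≤
(2x)^a` is enough. -/
theorem exists_regBeta_le {a : ℝ} (ha : 0 < a) :
    ∃ c : ℝ, 0 < c ∧ ∀ x ∈ Set.Icc (0 : ℝ) 1, regBeta x a (1 / 2) ≤ c * x ^ a := by
  have hB := beta_pos ha (one_half_pos (α := ℝ))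
  refine ⟨max (2 / (a * beta a (1 / 2))) (2 ^ a), lt_max_of_lt_right (by positivity), fun x hx => ?_⟩
  have hxa : 0 ≤ x ^ a := Real.rpow_nonneg hx.1 _
  rcases le_total x (1 / 2) with hx2 | hx2
  · refine le_trans ?_ (mul_le_mul_of_nonneg_right (le_max_left _ _) hxa)
    have h := intervalIntegrable_beta ha (one_half_pos (α := ℝ))
    have h0 := h.mono_set (Set.uIcc_subset_uIcc_left (by rwa [Set.uIcc_of_le zero_le_one] : x ∈ Set.uIcc (0 : ℝ) 1))
    have hint : ∫ t in (0 : ℝ)..x, t ^ (a - 1) = x ^ a / a := by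
      rw [integral_rpow (Or.inl (by linarith))]
      simp [Real.zero_rpow ha.ne']
    rw [regBeta, integral_beta ha one_half_pos, div_le_iff₀ hB]
    calc _ ≤ ∫ t in (0 : ℝ)..x, t ^ (a - 1) * 2 := by
          refine intervalIntegral.integral_mono_on_of_le_Ioo hx.1 h0
            ((intervalIntegral.intervalIntegrable_rpow' (by linarith)).mul_const _) fun t ht => ?_
          refine mul_le_mul_of_nonneg_left ?_ (Real.rpow_nonneg ht.1.le _)
          have ht2 : 1 / 2 ≤ 1 - t := by linarith [ht.2]
          calc (1 - t) ^ ((1 : ℝ) / 2 - 1) ≤ (1 / 2) ^ ((1 : ℝ) / 2 - 1) :=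
                Real.rpow_le_rpow_of_nonpos (by norm_num) ht2 (by norm_num)
            _ ≤ (1 / 2 : ℝ) ^ (-1 : ℝ) :=
                Real.rpow_le_rpow_of_exponent_ge (by norm_num) (by norm_num) (by norm_num)
            _ = 2 := by rw [Real.rpow_neg_one]; norm_num
      _ = 2 / (a * beta a (1 / 2)) * x ^ a * beta a (1 / 2) := by
          rw [intervalIntegral.integral_mul_const, hint]
          field_simp
  · refine le_trans ?_ (mul_le_mul_of_nonneg_right (le_max_right _ _) hxa)
    rw [← Real.mul_rpow zero_le_two hx.1]
    exact (regBeta_le_one ha one_half_pos hx).trans (Real.one_le_rpow (by linarith) ha.le)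

theorem regBeta_zero {a b : ℝ} : regBeta 0 a b = 0 := by simp [regBeta]

variable {d N : ℕ}

theorem betaIntegrand_natCast (hd : 1 ≤ d) (hN : d ≤ N) (t : ℝ) :
    t ^ ((d : ℝ) - 1) * (1 - t) ^ ((N : ℝ) - d + 1 - 1) = t ^ (d - 1) * (1 - t) ^ (N - d) := by
  rw [add_sub_cancel_right, ← Nat.cast_sub hN, ← Nat.cast_one (R := ℝ), ← Nat.cast_sub hd,
    Real.rpow_natCast, Real.rpow_natCast, Nat.cast_one]

theorem phiTail_eq (hd : 1 ≤ d) (hN : d ≤ N) {e : ℝ} (he : e ∈ Set.Icc (0 : ℝ) 1) :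
    phiTail e d N =
      (∫ t in e..1, t ^ (d - 1) * (1 - t) ^ (N - d)) / beta d ((N : ℝ) - d + 1) := by
  have h1 : (0 : ℝ) < d := by exact_mod_cast hd
  have h2 : (d : ℝ) ≤ N := by exact_mod_cast hN
  rw [phiTail, one_sub_regBeta h1 (by linarith) he]
  simp_rw [betaIntegrand_natCast hd hN]

theorem natCast_mul_beta_mul_choose (hd : 1 ≤ d) (hN : d ≤ N) :
    (d : ℝ) * beta d ((N : ℝ) - d + 1) * N.choose d = 1 := by
  have h1 : Real.Gamma d = (d - 1).factorial := by
    rw [← Real.Gamma_nat_eq_factorial, Nat.cast_sub hd, Nat.cast_one, sub_add_cancel]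
  have h2 : Real.Gamma ((N : ℝ) - d + 1) = (N - d).factorial := by
    rw [← Real.Gamma_nat_eq_factorial, Nat.cast_sub hN]
  rw [beta, h1, h2, show (d : ℝ) + (N - d + 1) = N + 1 by ring, Real.Gamma_nat_eq_factorial]
  have h3 : (N.choose d : ℝ) * d.factorial * (N - d).factorial = N.factorial := by
    exact_mod_cast Nat.choose_mul_factorial_mul_factorial hN
  have h4 : (d.factorial : ℝ) = d * (d - 1).factorial := by
    exact_mod_cast (Nat.mul_factorial_pred (by omega : d ≠ 0)).symm
  have h5 : (N.factorial : ℝ) ≠ 0 := by exact_mod_cast N.factorial_ne_zero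
  rw [h4] at h3
  field_simp
  linarith

/-- This is the union bound over `d`-subsets of trials for having `d` successes. In the integral it
amounts to dropping `(1 - t)^(N - d)`. -/
theorem one_sub_choose_mul_pow_le_phiTail (hd : 1 ≤ d) (hN : d ≤ N) {e : ℝ}
    (he : e ∈ Set.Icc (0 : ℝ) 1) : 1 - N.choose d * e ^ d ≤ phiTail e d N := by
  have h1 : (0 : ℝ) < d := by exact_mod_cast hd
  have h2 : (d : ℝ) ≤ N := by exact_mod_cast hN
  have hB := beta_pos h1 (by linarith : 0 < (N : ℝ) - d + 1)
  rw [phiTail, regBeta, integral_beta h1 (by linarith)]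
  simp_rw [betaIntegrand_natCast hd hN]
  refine sub_le_sub_left ((div_le_iff₀ hB).2 ?_) _
  have hint : ∫ t in (0 : ℝ)..e, t ^ (d - 1) = e ^ d / d := by
    rw [integral_pow]
    simp [Nat.sub_add_cancel hd, Nat.cast_sub hd, zero_pow (by omega : d ≠ 0)]
  calc ∫ t in (0 : ℝ)..e, t ^ (d - 1) * (1 - t) ^ (N - d) ≤ ∫ t in (0 : ℝ)..e, t ^ (d - 1) := by
        refine intervalIntegral.integral_mono_on he.1 (Continuous.intervalIntegrable (by fun_prop) _ _)
          (Continuous.intervalIntegrable (by fun_prop) _ _) fun t ht => ?_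
        exact mul_le_of_le_one_right (pow_nonneg ht.1 _)
          (pow_le_one₀ (by linarith [ht.2, he.2]) (by linarith [ht.1]))
    _ = e ^ d / d * (d * beta d ((N : ℝ) - d + 1) * N.choose d) := by
        rw [hint, natCast_mul_beta_mul_choose hd hN, mul_one]
    _ = N.choose d * e ^ d * beta d ((N : ℝ) - d + 1) := by field_simp

/-- No success at all is one way of having fewer than `d`. The proof substitutes `t = (1 - e)s + e`
and compares integrands using `t ≥ (1 - e)s`. -/
theorem one_sub_pow_le_phiTail (hd : 1 ≤ d) (hN : d ≤ N) {e : ℝ}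
    (he : e ∈ Set.Icc (0 : ℝ) 1) : (1 - e) ^ N ≤ phiTail e d N := by
  have h1 : (0 : ℝ) < d := by exact_mod_cast hd
  have h2 : (d : ℝ) ≤ N := by exact_mod_cast hN
  have hb : 0 < (N : ℝ) - d + 1 := by linarith
  have hB := beta_pos h1 hb
  rw [phiTail_eq hd hN he, le_div_iff₀ hB, ← integral_beta h1 hb]
  simp_rw [betaIntegrand_natCast hd hN]
  rcases he.2.eq_or_lt with rfl | he1
  · simp [zero_pow (by omega : N ≠ 0)]
  have hsub := intervalIntegral.integral_comp_mul_add (a := 0) (b := 1)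
    (fun t : ℝ => t ^ (d - 1) * (1 - t) ^ (N - d)) (sub_pos.2 he1).ne' e
  simp only [mul_zero, zero_add, mul_one, sub_add_cancel, smul_eq_mul] at hsub
  have hsub' : ∫ t in e..1, t ^ (d - 1) * (1 - t) ^ (N - d) =
      (1 - e) * ∫ s in (0 : ℝ)..1, ((1 - e) * s + e) ^ (d - 1) * (1 - ((1 - e) * s + e)) ^ (N - d) := by
    rw [hsub, mul_inv_cancel_left₀ (sub_pos.2 he1).ne']
  rw [hsub', ← intervalIntegral.integral_const_mul, ← intervalIntegral.integral_const_mul]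
  refine intervalIntegral.integral_mono_on zero_le_one
    (Continuous.intervalIntegrable (by fun_prop) _ _)
    (Continuous.intervalIntegrable (by fun_prop) _ _) fun s hs => ?_
  have hE : 0 ≤ 1 - e := by linarith
  have hs0 := hs.1
  have hs1 : 0 ≤ 1 - s := by linarith [hs.2]
  have hN' : N = 1 + (d - 1) + (N - d) := by omega
  calc (1 - e) ^ N * (s ^ (d - 1) * (1 - s) ^ (N - d))
      = (1 - e) * (((1 - e) * s) ^ (d - 1) * ((1 - e) * (1 - s)) ^ (N - d)) := by
        conv_lhs => rw [hN']
        rw [pow_add, pow_add, pow_one, mul_pow, mul_pow]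
        simp only [show 1 + (d - 1) + (N - d) - d = N - d by omega]
        ring
    _ ≤ (1 - e) * (((1 - e) * s + e) ^ (d - 1) * (1 - ((1 - e) * s + e)) ^ (N - d)) := by
        rw [show 1 - ((1 - e) * s + e) = (1 - e) * (1 - s) by ring]
        have := he.1
        gcongr
        linarith

/-- Markov's inequality: `phiTail` is the tail beyond `e` of the Beta law with parameters `d` and `N
- d + 1`, whose mean is `d / (N + 1)`. -/
theorem phiTail_le (hd : 1 ≤ d) (hN : d ≤ N) {e : ℝ} (he0 : 0 < e) (he1 : e ≤ 1) :
    phiTail e d N ≤ d / ((N + 1) * e) := by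
  have h1 : (0 : ℝ) < d := by exact_mod_cast hd
  have h2 : (d : ℝ) ≤ N := by exact_mod_cast hN
  have hb : 0 < (N : ℝ) - d + 1 := by linarith
  have hB := beta_pos h1 hb
  have hN1 : (0 : ℝ) < N + 1 := by linarith
  have hbeta := beta_add_one h1 hb
  rw [show (d : ℝ) + (N - d + 1) = N + 1 by ring] at hbeta
  have hint : ∫ t in (0 : ℝ)..1, t * (t ^ (d - 1) * (1 - t) ^ (N - d)) =
      beta (d + 1) ((N : ℝ) - d + 1) := by
    have := integral_beta (a := d + 1) (by linarith) hb
    have h3 := fun t => betaIntegrand_natCast (d := d + 1) (N := N + 1) (by omega) (by omega) t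
    push_cast at h3
    rw [← this]
    refine intervalIntegral.integral_congr fun t _ => ?_
    have h3 := h3 t
    rw [show (N : ℝ) + 1 - (d + 1) + 1 - 1 = N - d + 1 - 1 by ring] at h3
    rw [h3, ← mul_assoc, mul_pow_sub_one (by omega)]
  rw [phiTail_eq hd hN ⟨he0.le, he1⟩, div_le_iff₀ hB]
  calc ∫ t in e..1, t ^ (d - 1) * (1 - t) ^ (N - d)
      ≤ ∫ t in e..1, e⁻¹ * (t * (t ^ (d - 1) * (1 - t) ^ (N - d))) := by
        refine intervalIntegral.integral_mono_on he1
          (Continuous.intervalIntegrable (by fun_prop) _ _)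
          (Continuous.intervalIntegrable (by fun_prop) _ _) fun t ht => ?_
        have ht0 : 0 ≤ t := he0.le.trans ht.1
        have h3 : 0 ≤ t ^ (d - 1) * (1 - t) ^ (N - d) :=
          mul_nonneg (pow_nonneg ht0 _) (pow_nonneg (by linarith [ht.2]) _)
        rw [← mul_assoc]
        exact le_mul_of_one_le_left h3 ((one_le_inv_mul₀ he0).2 ht.1)
    _ ≤ ∫ t in (0 : ℝ)..1, e⁻¹ * (t * (t ^ (d - 1) * (1 - t) ^ (N - d))) := by
        refine intervalIntegral.integral_mono_interval he0.le he1 le_rfl ?_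
          (Continuous.intervalIntegrable (by fun_prop) _ _)
        refine (ae_restrict_iff' measurableSet_Ioc).2 (Eventually.of_forall fun t ht => ?_)
        exact mul_nonneg (inv_nonneg.2 he0.le) (mul_nonneg ht.1.le
          (mul_nonneg (pow_nonneg ht.1.le _) (pow_nonneg (by linarith [ht.2]) _)))
    _ = e⁻¹ * (d / (N + 1) * beta d ((N : ℝ) - d + 1)) := by
        rw [intervalIntegral.integral_const_mul, hint, hbeta]
    _ = d / ((N + 1) * e) * beta d ((N : ℝ) - d + 1) := by field_simp

end BetaFunction

/-! ### Uniform measure of narrow cones on the sphere -/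

section SphereCone

open scoped Pointwise

theorem exists_orthonormalBasis_zero_eq {m : ℕ} (u : EuclideanSpace ℝ (Fin (m + 1)))
    (hu : ‖u‖ = 1) :
    ∃ b : OrthonormalBasis (Fin (m + 1)) ℝ (EuclideanSpace ℝ (Fin (m + 1))), b 0 = u := by
  obtain ⟨b, hb⟩ := Orthonormal.exists_orthonormalBasis_extension_of_card_eq
    (𝕜 := ℝ) (ι := Fin (m + 1)) (E := EuclideanSpace ℝ (Fin (m + 1))) (by simp)
    (v := fun _ => u) (s := {0}) (by
      rw [orthonormal_iff_ite]
      intro i j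
      rw [if_pos (Subsingleton.elim i j)]
      simp [hu])
  exact ⟨b, hb 0 rfl⟩

instance isProbabilityMeasure_sphereUniform (m : ℕ) :
    IsProbabilityMeasure (sphereUniform (m + 1)) :=
  cond_isProbabilityMeasure (by
    rw [Ne, Measure.measure_univ_eq_zero]
    exact Measure.toSphere_ne_zero _)

/-- The part of the unit sphere in a circular cone of slope `r` has uniform measure at least a
constant times `r ^ (n - 1)`. -/
theorem exists_le_sphereUniform_cone (m : ℕ) :
    ∃ c : ℝ, 0 < c ∧ ∀ u : EuclideanSpace ℝ (Fin (m + 1)), ‖u‖ = 1 → ∀ r : ℝ, 0 < r → r ≤ 1 →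
      ∀ A : Set (UnitSphere (m + 1)), MeasurableSet A →
        (∀ x : UnitSphere (m + 1), 0 < inner ℝ u x.1 →
          ‖x.1 - inner ℝ u x.1 • u‖ < r * inner ℝ u x.1 → x ∈ A) →
        c * r ^ m ≤ (sphereUniform (m + 1)).real A := by
  set V : ℝ := (volume : Measure (EuclideanSpace ℝ (Fin (m + 1)))).real (Metric.ball 0 1) with hV
  have hVpos : 0 < V := ENNReal.toReal_pos (Metric.measure_ball_pos _ _ one_pos).ne'
    measure_ball_lt_top.ne
  refine ⟨1 / 4 * (1 / (2 * (m + 1))) ^ m / V, by positivity, fun u hu r hr hr1 A hA hcone => ?_⟩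
  obtain ⟨b, hb⟩ := exists_orthonormalBasis_zero_eq u hu
  -- A box with axial coordinate in `(1/4, 1/2)` and transverse part of norm below `r/4` lies both
  -- in the cone of slope `r` and in the unit ball. Its volume is an explicit multiple of `r ^ m`.
  set box : Set (Fin (m + 1) → ℝ) := Set.univ.pi fun i =>
    if i = 0 then Set.Ioo (1 / 4 : ℝ) (1 / 2)
    else Set.Ioo (-(r / (4 * (m + 1)))) (r / (4 * (m + 1))) with hbox
  have hboxm : MeasurableSet box := MeasurableSet.univ_pi fun i => by
    split_ifs <;> exact measurableSet_Ioo
  have hmp := (EuclideanSpace.volume_preserving_symm_measurableEquiv_toLp (Fin (m + 1))).comp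
    b.measurePreserving_repr
  set B : Set (EuclideanSpace ℝ (Fin (m + 1))) := {x | WithLp.ofLp (b.repr x) ∈ box} with hB
  have hBvol : (volume : Measure (EuclideanSpace ℝ (Fin (m + 1)))).real B =
      1 / 4 * (1 / (2 * (m + 1))) ^ m * r ^ m := by
    have h1 : (volume : Measure (EuclideanSpace ℝ (Fin (m + 1)))).real B =
        (volume : Measure (Fin (m + 1) → ℝ)).real box :=
      hmp.measureReal_preimage hboxm.nullMeasurableSet
    rw [h1, measureReal_def, hbox, volume_pi, Measure.pi_pi, ENNReal.toReal_prod,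
      Fin.prod_univ_succ]
    simp only [if_true, Fin.succ_ne_zero, if_false, Real.volume_Ioo, Finset.prod_const,
      Finset.card_univ, Fintype.card_fin]
    rw [ENNReal.toReal_ofReal (by norm_num), ENNReal.toReal_ofReal (by
      have : 0 < r / (4 * (m + 1)) := by positivity
      linarith), mul_assoc, ← mul_pow]
    congr 1
    · norm_num
    · congr 1
      field_simp
      ring
  have hsub : B ⊆ Set.Ioo (0 : ℝ) 1 • ((↑) '' A : Set (EuclideanSpace ℝ (Fin (m + 1)))) := by
    intro x hx
    have hx0 := hx 0 (Set.mem_univ _)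
    simp only [if_true] at hx0
    have hcoord : WithLp.ofLp (b.repr x) 0 = inner ℝ u x := by
      rw [← hb]; exact b.repr_apply_apply x 0
    rw [hcoord] at hx0
    have hw : x - inner ℝ u x • u = ∑ i : Fin m, (b.repr x) i.succ • b i.succ := by
      have := b.sum_repr x
      rw [Fin.sum_univ_succ, hb] at this
      conv_lhs => rw [← hcoord]; enter [1]; rw [← this]
      exact add_sub_cancel_left _ _
    have hwn : ‖x - inner ℝ u x • u‖ < r / 4 := by
      rw [hw]
      calc _ ≤ ∑ i : Fin m, ‖(b.repr x) i.succ • b i.succ‖ := norm_sum_le _ _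
        _ ≤ ∑ _i : Fin m, r / (4 * (m + 1)) := by
            refine Finset.sum_le_sum fun i _ => ?_
            have hi := hx i.succ (Set.mem_univ _)
            simp only [Fin.succ_ne_zero, if_false] at hi
            rw [norm_smul, b.norm_eq_one, mul_one, Real.norm_eq_abs]
            exact (abs_lt.2 hi).le
        _ = m * (r / (4 * (m + 1))) := by simp
        _ < (m + 1) * (r / (4 * (m + 1))) := by
            have : 0 < r / (4 * (m + 1)) := by positivity
            linarith
        _ = r / 4 := by field_simp
    have hnorm : ‖x‖ < 1 := by
      calc ‖x‖ = ‖(x - inner ℝ u x • u) + inner ℝ u x • u‖ := by rw [sub_add_cancel]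
        _ ≤ ‖x - inner ℝ u x • u‖ + ‖inner ℝ u x • u‖ := norm_add_le _ _
        _ < 1 / 4 + 1 / 2 := by
            rw [norm_smul, hu, mul_one, Real.norm_eq_abs, abs_of_pos (by linarith [hx0.1])]
            linarith [hx0.2]
        _ ≤ 1 := by norm_num
    have hxne : x ≠ 0 := by
      rintro rfl
      rw [inner_zero_right] at hx0
      linarith [hx0.1]
    have hpos : 0 < ‖x‖ := norm_pos_iff.2 hxne
    have hinv : 0 < ‖x‖⁻¹ := inv_pos.2 hpos
    have hmem : ‖x‖⁻¹ • x ∈ Metric.sphere (0 : EuclideanSpace ℝ (Fin (m + 1))) 1 := by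
      simp [norm_smul, hpos.ne']
    refine Set.mem_smul.2 ⟨‖x‖, ⟨hpos, hnorm⟩, ‖x‖⁻¹ • x, ⟨⟨_, hmem⟩, hcone _ ?_ ?_, rfl⟩, ?_⟩
    · rw [inner_smul_right]
      exact mul_pos hinv (by linarith [hx0.1])
    · rw [inner_smul_right, mul_smul, ← smul_sub, norm_smul, Real.norm_of_nonneg hinv.le,
        mul_left_comm]
      refine mul_lt_mul_of_pos_left (hwn.trans ?_) hinv
      nlinarith [hx0.1]
    · rw [smul_smul, mul_inv_cancel₀ hpos.ne', one_smul]
  -- Surface measure is the dimension times the volume of the truncated cone; the dimension cancels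
  -- on normalising.
  have hsphere : (sphereUniform (m + 1)).real A =
      (volume : Measure (EuclideanSpace ℝ (Fin (m + 1)))).real
        (Set.Ioo (0 : ℝ) 1 • ((↑) '' A : Set (EuclideanSpace ℝ (Fin (m + 1))))) / V := by
    rw [sphereUniform, measureReal_def, cond_apply MeasurableSet.univ, Set.univ_inter,
      ENNReal.toReal_mul, ENNReal.toReal_inv, Measure.toSphere_apply_univ,
      Measure.toSphere_apply' _ hA, ENNReal.toReal_mul, ENNReal.toReal_mul]
    have hdim : (((Module.finrank ℝ (EuclideanSpace ℝ (Fin (m + 1))) : ℕ) : ENNReal)).toReal ≠ 0 := by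
      rw [ENNReal.toReal_natCast, finrank_euclideanSpace_fin]
      positivity
    change (_ * V)⁻¹ * _ = _
    rw [← measureReal_def]
    field_simp
  rw [hsphere, div_mul_eq_mul_div, ← hBvol]
  gcongr
  refine ((measure_mono ?_).trans_lt (measure_ball_lt_top (x := (0 : EuclideanSpace ℝ (Fin (m + 1)))) (r := 1))).ne
  rintro _ ⟨t, ht, _, ⟨x, -, rfl⟩, rfl⟩
  have hx : ‖x.1‖ = 1 := by simp
  simp [norm_smul, hx, abs_of_pos ht.1, ht.2]

end SphereCone

/-! ### A quadratic form near a point of maximal ratio -/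

section QuadraticForms

/-- If `R ≤ ρ Q` with equality at `u`, then `R` is bounded below along `u + w`. -/
theorem le_dotProduct_mulVec_of_eq {ι : Type*} [Fintype ι] {Q R : Matrix ι ι ℝ} {ρ : ℝ}
    {u : ι → ℝ} (hQ : Q.IsHermitian) (hR : R.PosSemidef)
    (hle : ∀ x, x ⬝ᵥ (R *ᵥ x) ≤ ρ * (x ⬝ᵥ (Q *ᵥ x)))
    (hu : u ⬝ᵥ (R *ᵥ u) = ρ * (u ⬝ᵥ (Q *ᵥ u))) (s : ℝ) (w : ι → ℝ) :
    ρ * ((s • u + w) ⬝ᵥ (Q *ᵥ (s • u + w)) - w ⬝ᵥ (Q *ᵥ w)) ≤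
      (s • u + w) ⬝ᵥ (R *ᵥ (s • u + w)) := by
  have hpsd : (ρ • Q - R).PosSemidef := by
    refine PosSemidef.of_dotProduct_mulVec_nonneg ((hQ.smul (by simp [IsSelfAdjoint])).sub hR.1) fun x => ?_
    simp only [sub_mulVec, smul_mulVec, dotProduct_sub, dotProduct_smul, smul_eq_mul, star_trivial]
    linarith [hle x]
  -- A semidefinite matrix annihilates every zero of its form. Thus the terms of `R` involving `u`
  -- are `ρ` times those of `Q`, and only the nonnegative `wᵀ R w` is discarded.
  have hnull : (ρ • Q - R) *ᵥ u = 0 := by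
    refine (hpsd.dotProduct_mulVec_zero_iff u).1 ?_
    simp only [sub_mulVec, smul_mulVec, dotProduct_sub, dotProduct_smul, smul_eq_mul, star_trivial]
    linarith
  have hRu : R *ᵥ u = ρ • (Q *ᵥ u) := by
    rw [sub_mulVec, smul_mulVec, sub_eq_zero] at hnull
    exact hnull.symm
  have hsymm : ∀ (A : Matrix ι ι ℝ), A.IsHermitian → u ⬝ᵥ (A *ᵥ w) = w ⬝ᵥ (A *ᵥ u) := fun A hA => by
    have hA' : Aᵀ = A := by simpa [Matrix.IsHermitian, conjTranspose_eq_transpose_of_trivial] using hA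
    rw [dotProduct_mulVec, ← mulVec_transpose, hA', dotProduct_comm]
  have hw := hR.dotProduct_mulVec_nonneg w
  rw [star_trivial] at hw
  simp only [mulVec_add, mulVec_smul, dotProduct_add, add_dotProduct, smul_dotProduct,
    dotProduct_smul, smul_eq_mul, hsymm R hR.1, hsymm Q hQ, hRu]
  nlinarith [hw]

end QuadraticForms

/-! ### Output windows, observability and feasibility of the programs -/

namespace SLS

variable {n p M : ℕ} (S : SLS n p M)

section Windows

variable {T T' : ℕ} {σ : Fin T → Fin M} {σ' : Fin T' → Fin M} {l : ℕ}

theorem transition_add (hT : l + T' ≤ T) (hσ : ∀ i : Fin T', σ' i = σ ⟨l + i, by omega⟩) {t : ℕ}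
    (ht : t ≤ T') : S.transition σ (l + t) = S.transition σ' t * S.transition σ l := by
  induction t with
  | zero => simp [transition]
  | succ t ih =>
    have h1 : l + t < T := by omega
    have h2 : t < T' := by omega
    rw [← add_assoc, transition, transition, dif_pos h1, dif_pos h2, ih (by omega), hσ,
      Matrix.mul_assoc]

theorem window_add (hT : l + T' ≤ T) (hσ : ∀ i : Fin T', σ' i = σ ⟨l + i, by omega⟩)
    (x : Fin n → ℝ) {j k : ℕ} (hjk : j + k ≤ T') :
    S.window σ x (l + j) k = S.window σ' (S.transition σ l *ᵥ x) j k := by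
  ext ⟨i, a⟩
  have h1 : l + (j + (i : ℕ)) < T := by omega
  have h2 : j + (i : ℕ) < T' := by omega
  have h3 := S.transition_add hT hσ (t := j + i) (by omega)
  have h4 := hσ ⟨j + i, h2⟩
  simp only [window, output, dif_pos h1, dif_pos h2, h3, h4, mulVec_mulVec, add_assoc]

/-- The linear map from the state to a window of outputs. -/
def windowMap {T : ℕ} (σ : Fin T → Fin M) (l k : ℕ) : (Fin n → ℝ) →ₗ[ℝ] (Fin k × Fin p → ℝ) where
  toFun x := S.window σ x l k
  map_add' x y := by
    ext ij
    simp only [window, output, Pi.add_apply]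
    split_ifs <;> simp [mulVec_add]
  map_smul' c x := by
    ext ij
    simp only [window, output, Pi.smul_apply, RingHom.id_apply]
    split_ifs <;> simp [mulVec_smul]

theorem window_smul {T : ℕ} (σ : Fin T → Fin M) (l k : ℕ) (c : ℝ) (x : Fin n → ℝ) :
    S.window σ (c • x) l k = c • S.window σ x l k := (S.windowMap σ l k).map_smul c x

/-- The quadratic form `x ↦ wᵀ P w` of a window `w` of the trajectory from `x`, as a matrix. -/
noncomputable def windowForm {T : ℕ} (σ : Fin T → Fin M) (l k : ℕ)
    (P : Matrix (Fin k × Fin p) (Fin k × Fin p) ℝ) : Matrix (Fin n) (Fin n) ℝ :=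
  (LinearMap.toMatrix' (S.windowMap σ l k))ᵀ * P * LinearMap.toMatrix' (S.windowMap σ l k)

theorem dotProduct_windowForm_mulVec {T : ℕ} (σ : Fin T → Fin M) (l k : ℕ)
    (P : Matrix (Fin k × Fin p) (Fin k × Fin p) ℝ) (x : Fin n → ℝ) :
    x ⬝ᵥ (S.windowForm σ l k P *ᵥ x) = S.window σ x l k ⬝ᵥ (P *ᵥ S.window σ x l k) := by
  have h : LinearMap.toMatrix' (S.windowMap σ l k) *ᵥ x = S.window σ x l k := by
    rw [LinearMap.toMatrix'_mulVec]; rfl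
  rw [windowForm, ← mulVec_mulVec, ← mulVec_mulVec, h, dotProduct_mulVec, vecMul_transpose, h]

theorem windowForm_posSemidef {T : ℕ} (σ : Fin T → Fin M) (l k : ℕ)
    {P : Matrix (Fin k × Fin p) (Fin k × Fin p) ℝ} (hP : P.PosSemidef) :
    (S.windowForm σ l k P).PosSemidef := by
  have := hP.conjTranspose_mul_mul_same (LinearMap.toMatrix' (S.windowMap σ l k))
  rwa [conjTranspose_eq_transpose_of_trivial] at this

end Windows

theorem dotProduct_self_eq_norm_sq {ι : Type*} [Fintype ι] (x : ι → ℝ) :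
    x ⬝ᵥ x = ‖WithLp.toLp 2 x‖ ^ 2 := by
  rw [EuclideanSpace.real_norm_sq_eq]
  simp [dotProduct, sq]

theorem exists_dotProduct_map_le {ι κ : Type*} [Fintype ι] [Fintype κ]
    (L : (ι → ℝ) →ₗ[ℝ] (κ → ℝ)) :
    ∃ K : ℝ, 0 ≤ K ∧ ∀ x, L x ⬝ᵥ L x ≤ K * (x ⬝ᵥ x) := by
  set L' : EuclideanSpace ℝ ι →L[ℝ] EuclideanSpace ℝ κ := LinearMap.toContinuousLinearMap
    ((WithLp.linearEquiv 2 ℝ (κ → ℝ)).symm.toLinearMap ∘ₗ L ∘ₗ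
      (WithLp.linearEquiv 2 ℝ (ι → ℝ)).toLinearMap) with hL'
  refine ⟨‖L'‖ ^ 2, by positivity, fun x => ?_⟩
  rw [dotProduct_self_eq_norm_sq, dotProduct_self_eq_norm_sq, ← mul_pow]
  exact pow_le_pow_left₀ (norm_nonneg _) (L'.le_opNorm (WithLp.toLp 2 x)) 2

theorem exists_dotProduct_le_map {ι κ : Type*} [Fintype ι] [Fintype κ]
    (L : (ι → ℝ) →ₗ[ℝ] (κ → ℝ)) (hL : ∀ x, L x = 0 → x = 0) :
    ∃ K : ℝ, 0 ≤ K ∧ ∀ x, x ⬝ᵥ x ≤ K * (L x ⬝ᵥ L x) := by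
  obtain ⟨g, hg⟩ := L.exists_leftInverse_of_injective (LinearMap.ker_eq_bot'.2 hL)
  obtain ⟨K, hK, h⟩ := exists_dotProduct_map_le g
  refine ⟨K, hK, fun x => ?_⟩
  have := h (L x)
  rwa [show g (L x) = x from LinearMap.congr_fun hg x] at this

theorem exists_window_le (T l k : ℕ) :
    ∃ K : ℝ, 0 ≤ K ∧ ∀ (σ : Fin T → Fin M) (x : Fin n → ℝ),
      S.window σ x l k ⬝ᵥ S.window σ x l k ≤ K * (x ⬝ᵥ x) := by
  choose K hK0 hK using fun σ : Fin T → Fin M => exists_dotProduct_map_le (S.windowMap σ l k)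
  refine ⟨∑ σ, K σ, Finset.sum_nonneg fun σ _ => hK0 σ, fun σ x => (hK σ x).trans ?_⟩
  exact mul_le_mul_of_nonneg_right (Finset.single_le_sum (fun σ _ => hK0 σ) (Finset.mem_univ σ))
    (dotProduct_self_eq_norm_sq x ▸ sq_nonneg _)

variable {k : ℕ}

/-- An index at most `k` yields some length `k' ≤ k` at which every word is observable, and the
first `k'` outputs are among the first `k`. -/
theorem observable_of_pathwiseIndex_le (hk : S.pathwiseIndex ≤ (k : ℕ∞)) {T : ℕ} (hT : k ≤ T)
    (σ : Fin T → Fin M) {x : Fin n → ℝ} (hx : S.window σ x 0 k = 0) : x = 0 := by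
  obtain ⟨k', hk', hobs⟩ : ∃ k' ≤ k, ∀ σ : Fin k' → Fin M, S.Observable σ := by
    by_contra! h
    have : ((k + 1 : ℕ) : ℕ∞) ≤ S.pathwiseIndex := le_iInf₂ fun k' hk' => by
      by_contra! hlt
      have hlt' : k' < k + 1 := by exact_mod_cast hlt
      obtain ⟨σ, hσ⟩ := h k' (by omega)
      exact hσ (hk' σ)
    have := this.trans hk
    have : k + 1 ≤ k := by exact_mod_cast this
    omega
  refine hobs (fun i => σ ⟨0 + i, by omega⟩) x ?_
  have h := S.window_add (σ := σ) (σ' := fun i : Fin k' => σ ⟨0 + i, by omega⟩) (l := 0) (by omega)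
    (fun i => rfl) x (j := 0) (k := k') (by omega)
  simp only [transition, one_mulVec, add_zero] at h
  rw [← h]
  ext ⟨i, a⟩
  simpa [window] using congrFun hx (⟨i, by omega⟩, a)

/-- The first window depends only on the first `k` letters, so finitely many injective maps are
involved and `K` is uniform in `T`. This is why the final constant depends on the system and `k`
alone. -/
theorem exists_window_bounds (hk : S.pathwiseIndex ≤ (k : ℕ∞)) :
    ∃ K : ℝ, 1 ≤ K ∧ ∀ (T : ℕ) (σ : Fin T → Fin M) (x : Fin n → ℝ), k ≤ T →
      x ⬝ᵥ x ≤ K * (S.window σ x 0 k ⬝ᵥ S.window σ x 0 k) ∧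
        S.window σ x 0 k ⬝ᵥ S.window σ x 0 k ≤ K * (x ⬝ᵥ x) := by
  choose K hK0 hK using fun σ : Fin k → Fin M => exists_dotProduct_le_map (S.windowMap σ 0 k)
    fun x hx => S.observable_of_pathwiseIndex_le hk le_rfl σ hx
  obtain ⟨K', hK'0, hK'⟩ := S.exists_window_le k 0 k
  have hsum : 0 ≤ ∑ σ, K σ := Finset.sum_nonneg fun σ _ => hK0 σ
  refine ⟨∑ σ, K σ + K' + 1, by linarith, fun T σ x hT => ?_⟩
  have h := S.window_add (σ := σ) (σ' := fun i : Fin k => σ ⟨0 + i, by omega⟩) (l := 0) (by omega)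
    (fun i => rfl) x (j := 0) (k := k) (by omega)
  simp only [transition, one_mulVec, add_zero] at h
  rw [h]
  set σ' := fun i : Fin k => σ ⟨0 + i, by omega⟩
  have hw : 0 ≤ S.window σ' x 0 k ⬝ᵥ S.window σ' x 0 k := dotProduct_self_eq_norm_sq (S.window σ' x 0 k) ▸ sq_nonneg _
  have hx : 0 ≤ x ⬝ᵥ x := dotProduct_self_eq_norm_sq x ▸ sq_nonneg _
  have hle := Finset.single_le_sum (fun σ _ => hK0 σ) (Finset.mem_univ σ')
  exact ⟨(hK σ' x).trans (mul_le_mul_of_nonneg_right (by linarith) hw),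
    (hK' σ' x).trans (mul_le_mul_of_nonneg_right (by linarith) hx)⟩

section Feasibility

variable {T : ℕ}

theorem dotProduct_le_of_posSemidef_sub {ι : Type*} [Fintype ι] {A B : Matrix ι ι ℝ}
    (h : (B - A).PosSemidef) (x : ι → ℝ) : x ⬝ᵥ (A *ᵥ x) ≤ x ⬝ᵥ (B *ᵥ x) := by
  have := h.dotProduct_mulVec_nonneg x
  rw [star_trivial, sub_mulVec, dotProduct_sub] at this
  linarith

theorem posSemidef_of_sub_one {ι : Type*} [Fintype ι] [DecidableEq ι] {P : Matrix ι ι ℝ}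
    (h : (P - 1).PosSemidef) : P.PosSemidef := by
  simpa using h.add PosSemidef.one

theorem dotProduct_mulVec_nonneg_of_sub_one {ι : Type*} [Fintype ι] [DecidableEq ι]
    {P : Matrix ι ι ℝ} (h : (P - 1).PosSemidef) (x : ι → ℝ) : 0 ≤ x ⬝ᵥ (P *ᵥ x) := by
  simpa using (posSemidef_of_sub_one h).dotProduct_mulVec_nonneg x

theorem Decrease.mono {γ γ' : ℝ} (hγ : 0 ≤ γ) (hγ' : γ ≤ γ')
    {P : Matrix (Fin k × Fin p) (Fin k × Fin p) ℝ} (hP : P.PosSemidef)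
    {σ : Fin T → Fin M} {x : Fin n → ℝ} (h : S.Decrease k γ P σ x) : S.Decrease k γ' P σ x := by
  refine le_trans h (mul_le_mul_of_nonneg_right (pow_le_pow_left₀ hγ hγ' _) ?_)
  simpa using hP.dotProduct_mulVec_nonneg _

theorem gammaRobust_le {γ : ℝ} {P : Matrix (Fin k × Fin p) (Fin k × Fin p) ℝ}
    (h : S.RobustFeasible k T γ P) : S.gammaRobust k T ≤ γ :=
  csInf_le ⟨0, fun _ ⟨_, h⟩ => h.1⟩ ⟨P, h⟩

/-- Ensures that the infima defining `gammaRobust` and `gammaStar` are over nonempty sets. The level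
is taken at least one so that raising it to the power `2(T - k)` does not decrease it. -/
theorem exists_robustFeasible_one (hk : S.pathwiseIndex ≤ (k : ℕ∞)) (hT : k < T) :
    ∃ γ : ℝ, S.RobustFeasible k T γ 1 := by
  obtain ⟨K, hK1, hK⟩ := S.exists_window_bounds hk
  obtain ⟨K', hK'0, hK'⟩ := S.exists_window_le T (T - k) k
  have hγ : 1 ≤ K' * K + 1 := by nlinarith
  refine ⟨K' * K + 1, by linarith, by simpa using PosSemidef.zero, fun σ x => ?_⟩
  simp only [Decrease, one_mulVec]
  have hv : 0 ≤ S.window σ x 0 k ⬝ᵥ S.window σ x 0 k := dotProduct_self_eq_norm_sq (S.window σ x 0 k) ▸ sq_nonneg _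
  calc _ ≤ K' * (x ⬝ᵥ x) := hK' σ x
    _ ≤ K' * (K * (S.window σ x 0 k ⬝ᵥ S.window σ x 0 k)) := by
        gcongr
        exact (hK T σ x hT.le).1
    _ ≤ (K' * K + 1) ^ 1 * (S.window σ x 0 k ⬝ᵥ S.window σ x 0 k) := by nlinarith
    _ ≤ _ := by
        gcongr
        omega

theorem exists_robustFeasible_of_gammaRobust_lt (hk : S.pathwiseIndex ≤ (k : ℕ∞)) (hT : k < T)
    {γ : ℝ} (h : S.gammaRobust k T < γ) : ∃ γ' P, γ' < γ ∧ S.RobustFeasible k T γ' P := by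
  obtain ⟨γ₀, h₀⟩ := S.exists_robustFeasible_one hk hT
  obtain ⟨γ', ⟨P, hP⟩, hlt⟩ := exists_lt_of_csInf_lt (s := {γ : ℝ | ∃ P, S.RobustFeasible k T γ P})
    ⟨γ₀, 1, h₀⟩ h
  exact ⟨γ', P, hlt, hP⟩

theorem gammaStar_lt_iff (hk : S.pathwiseIndex ≤ (k : ℕ∞)) (hT : k < T) {lam : ℝ}
    (hlam : 1 ≤ lam) {N : ℕ} (ω : Fin N → Datum n M T) (γ : ℝ) :
    S.gammaStar k T lam ω < γ ↔ ∃ γ' P, γ' < γ ∧ S.ScenarioFeasible k T lam ω γ' P := by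
  constructor
  · intro h
    obtain ⟨γ₀, h₀⟩ := S.exists_robustFeasible_one hk hT
    have h1 : (lam • (1 : Matrix (Fin k × Fin p) (Fin k × Fin p) ℝ) - 1).PosSemidef := by
      have := (PosSemidef.one (n := Fin k × Fin p) (R := ℝ)).smul (sub_nonneg.2 hlam)
      rwa [sub_smul, one_smul] at this
    obtain ⟨γ', ⟨P, hP⟩, hlt⟩ := exists_lt_of_csInf_lt
      (s := {γ : ℝ | ∃ P, S.ScenarioFeasible k T lam ω γ P})
      ⟨γ₀, 1, h₀.1, h₀.2.1, h1, fun i => h₀.2.2 _ _⟩ h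
    exact ⟨γ', P, hlt, hP⟩
  · rintro ⟨γ', P, hlt, hP⟩
    exact (csInf_le (s := {γ : ℝ | ∃ P, S.ScenarioFeasible k T lam ω γ P})
      ⟨0, fun _ ⟨_, h⟩ => h.1⟩ ⟨P, hP⟩).trans_lt hlt

theorem gammaRobust_nonneg : 0 ≤ S.gammaRobust k T := Real.sInf_nonneg fun _ ⟨_, h⟩ => h.1

theorem gammaStar_nonneg {lam : ℝ} {N : ℕ} (ω : Fin N → Datum n M T) :
    0 ≤ S.gammaStar k T lam ω := Real.sInf_nonneg fun _ ⟨_, h⟩ => h.1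

end Feasibility

end SLS

instance isProbabilityMeasure_datumLaw (m M T : ℕ) [NeZero M] :
    IsProbabilityMeasure (datumLaw (m + 1) M T) := by
  have : IsProbabilityMeasure (uniformOn (Set.univ : Set (Fin M))) :=
    isProbabilityMeasure_uniformOn Set.finite_univ Set.univ_nonempty
  rw [datumLaw]
  infer_instance

instance isProbabilityMeasure_sampleLaw (m M T N : ℕ) [NeZero M] :
    IsProbabilityMeasure (sampleLaw (m + 1) M T N) := by
  rw [sampleLaw]
  infer_instance

theorem datumLaw_real_prod_singleton (m M T : ℕ) [NeZero M] (A : Set (UnitSphere (m + 1)))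
    (σ : Fin T → Fin M) :
    (datumLaw (m + 1) M T).real (A ×ˢ {σ}) = (sphereUniform (m + 1)).real A / (M : ℝ) ^ T := by
  have : IsProbabilityMeasure (uniformOn (Set.univ : Set (Fin M))) :=
    isProbabilityMeasure_uniformOn Set.finite_univ Set.univ_nonempty
  rw [datumLaw, measureReal_prod_prod, measureReal_def (s := {σ}), Measure.pi_singleton]
  simp [uniformOn_univ, div_eq_mul_inv]

namespace SLS

theorem continuous_window {n p M : ℕ} (S : SLS n p M) (T l k : ℕ) :
    Continuous fun δ : Datum n M T => S.window δ.2 (WithLp.ofLp δ.1.1) l k := by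
  refine continuous_prod_of_discrete_right.2 fun σ => ?_
  exact (S.windowMap σ l k).continuous_of_finiteDimensional.comp (by fun_prop)

/-! ### Probability that a datum violates a given Lyapunov matrix -/

section Violation

variable {m p M k : ℕ} [NeZero M] (S : SLS (m + 1) p M)

/-- For a Lyapunov matrix `P`, some trajectory attains the maximal growth, which is at least the
optimal one. -/
theorem exists_maximal_growth (hk : S.pathwiseIndex ≤ (k : ℕ∞)) {T : ℕ} (hT : k < T)
    {P : Matrix (Fin k × Fin p) (Fin k × Fin p) ℝ} (hP : (P - 1).PosSemidef) :
    ∃ (ρ : ℝ) (σ₀ : Fin T → Fin M) (u : EuclideanSpace ℝ (Fin (m + 1))), ‖u‖ = 1 ∧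
      S.gammaRobust k T ^ (2 * (T - k)) ≤ ρ ∧
      S.window σ₀ u.ofLp (T - k) k ⬝ᵥ (P *ᵥ S.window σ₀ u.ofLp (T - k) k) =
        ρ * (S.window σ₀ u.ofLp 0 k ⬝ᵥ (P *ᵥ S.window σ₀ u.ofLp 0 k)) ∧
      ∀ (σ : Fin T → Fin M) (x : Fin (m + 1) → ℝ),
        S.window σ x (T - k) k ⬝ᵥ (P *ᵥ S.window σ x (T - k) k) ≤
          ρ * (S.window σ x 0 k ⬝ᵥ (P *ᵥ S.window σ x 0 k)) := by
  have hPpsd := posSemidef_of_sub_one hP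
  have hnn : ∀ w, 0 ≤ w ⬝ᵥ (P *ᵥ w) := dotProduct_mulVec_nonneg_of_sub_one hP
  have hpos : ∀ (σ : Fin T → Fin M) (x : Fin (m + 1) → ℝ), x ≠ 0 →
      0 < S.window σ x 0 k ⬝ᵥ (P *ᵥ S.window σ x 0 k) := fun σ x hx => by
    have h1 := dotProduct_le_of_posSemidef_sub hP (S.window σ x 0 k)
    rw [one_mulVec] at h1
    have h2 : S.window σ x 0 k ≠ 0 := fun h => hx (S.observable_of_pathwiseIndex_le hk hT.le σ h)
    have h3 : 0 < S.window σ x 0 k ⬝ᵥ S.window σ x 0 k := by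
      rw [dotProduct_self_eq_norm_sq]
      have : WithLp.toLp 2 (S.window σ x 0 k) ≠ 0 := by simpa using h2
      positivity
    linarith
  have hne : ∀ x : UnitSphere (m + 1), WithLp.ofLp x.1 ≠ 0 := fun x h => by
    have h1 : ‖x.1‖ = 1 := by simp
    have h2 : x.1 = 0 := by simpa using h
    rw [h2, norm_zero] at h1
    exact zero_ne_one h1
  have hcont : ∀ l, Continuous fun δ : Datum (m + 1) M T =>
      S.window δ.2 (WithLp.ofLp δ.1.1) l k ⬝ᵥ (P *ᵥ S.window δ.2 (WithLp.ofLp δ.1.1) l k) :=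
    fun l => by
      have := S.continuous_window T l k
      exact this.dotProduct (continuous_const.matrix_mulVec this)
  have hnonempty : Nonempty (UnitSphere (m + 1)) :=
    (NormedSpace.sphere_nonempty.2 zero_le_one).to_subtype
  -- The ratio of last to first window energy is continuous because observability keeps its
  -- denominator positive. It is homogeneous of degree zero, so the maximum over the sphere is
  -- global.
  obtain ⟨⟨u, σ₀⟩, -, hmax⟩ := (isCompact_univ (X := Datum (m + 1) M T)).exists_isMaxOn
    Set.univ_nonempty ((hcont (T - k)).div (hcont 0) fun δ => (hpos δ.2 _ (hne δ.1)).ne').continuousOn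
  set ρ := S.window σ₀ u.1.ofLp (T - k) k ⬝ᵥ (P *ᵥ S.window σ₀ u.1.ofLp (T - k) k) /
    (S.window σ₀ u.1.ofLp 0 k ⬝ᵥ (P *ᵥ S.window σ₀ u.1.ofLp 0 k)) with hρ
  have hρ0 : 0 ≤ ρ := div_nonneg (hnn _) (hnn _)
  have hall : ∀ (σ : Fin T → Fin M) (x : Fin (m + 1) → ℝ),
        S.window σ x (T - k) k ⬝ᵥ (P *ᵥ S.window σ x (T - k) k) ≤
          ρ * (S.window σ x 0 k ⬝ᵥ (P *ᵥ S.window σ x 0 k)) := fun σ x => by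
    rcases eq_or_ne x 0 with rfl | hx
    · have : ∀ l, S.window σ 0 l k = 0 := fun l => (S.windowMap σ l k).map_zero
      simp [this]
    · have hx' : WithLp.toLp 2 x ≠ 0 := by simpa using hx
      have hn : 0 < ‖WithLp.toLp 2 x‖ := norm_pos_iff.2 hx'
      set y : UnitSphere (m + 1) := ⟨‖WithLp.toLp 2 x‖⁻¹ • WithLp.toLp 2 x, by
        simp [norm_smul, hn.ne']⟩ with hy
      have hxy : x = ‖WithLp.toLp 2 x‖ • y.1.ofLp := by
        simp [hy, smul_smul, hn.ne']
      have h1 := hmax (Set.mem_univ (y, σ))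
      simp only [Set.mem_ofPred_eq, Pi.div_apply] at h1
      rw [← hρ, div_le_iff₀ (hpos σ _ (hne y))] at h1
      rw [hxy]
      simp only [window_smul, mulVec_smul, dotProduct_smul, smul_dotProduct, smul_eq_mul]
      have h2 := mul_le_mul_of_nonneg_left h1 (mul_self_nonneg ‖WithLp.toLp 2 x‖)
      linarith
  refine ⟨ρ, σ₀, u.1, by simp, ?_, (div_mul_cancel₀ _ (hpos σ₀ _ (hne u)).ne').symm, hall⟩
  have hm : (2 * (T - k)) ≠ 0 := by omega
  -- The root of `ρ` is a feasible robust level for this `P`, hence at least the optimum.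
  have hfeas : S.RobustFeasible k T (ρ ^ ((2 * (T - k) : ℕ) : ℝ)⁻¹) P := by
    refine ⟨Real.rpow_nonneg hρ0 _, hP, fun σ x => ?_⟩
    rw [Decrease, Real.rpow_inv_natCast_pow hρ0 hm]
    exact hall σ x
  calc _ ≤ (ρ ^ ((2 * (T - k) : ℕ) : ℝ)⁻¹) ^ (2 * (T - k)) :=
        pow_le_pow_left₀ S.gammaRobust_nonneg (S.gammaRobust_le hfeas) _
    _ = ρ := Real.rpow_inv_natCast_pow hρ0 hm

/-- A Lyapunov matrix is violated at a level below the optimal one with a probability that is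
bounded below. -/
theorem exists_le_datumLaw_not_decrease (hk : S.pathwiseIndex ≤ (k : ℕ∞)) :
    ∃ c : ℝ, 0 < c ∧ ∀ (T : ℕ) (lam ε : ℝ), k < T → 1 ≤ lam → 0 < ε → 0 < S.gammaRobust k T →
      ∀ P : Matrix (Fin k × Fin p) (Fin k × Fin p) ℝ, (P - 1).PosSemidef →
        (lam • 1 - P).PosSemidef →
        c * √((1 - 1 / (1 + ε) ^ (2 * (T - k))) / lam) ^ m / (M : ℝ) ^ T ≤
          (datumLaw (m + 1) M T).real
            {δ | ¬ S.Decrease k (S.gammaRobust k T / (1 + ε)) P δ.2 (WithLp.ofLp δ.1.1)} := by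
  obtain ⟨K, hK1, hK⟩ := S.exists_window_bounds hk
  obtain ⟨c, hc, hcone⟩ := exists_le_sphereUniform_cone m
  have hKpos : 0 < K := by linarith
  refine ⟨c * (1 / K) ^ m, by positivity, fun T lam ε hT hlam hε hγ P hP hPlam => ?_⟩
  obtain ⟨ρ, σ₀, u, hu, hρ, hmax, hall⟩ := S.exists_maximal_growth hk hT hP
  set h : ℝ := 1 - 1 / (1 + ε) ^ (2 * (T - k)) with hh
  have hpow : 1 < (1 + ε) ^ (2 * (T - k)) := one_lt_pow₀ (by linarith) (by omega)
  have hpow' : 1 / (1 + ε) ^ (2 * (T - k)) < 1 := (div_lt_one (by linarith)).2 hpow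
  have hpow0 : 0 < 1 / (1 + ε) ^ (2 * (T - k)) := by positivity
  have hh0 : 0 < h := by linarith
  have hh1 : h < 1 := by linarith
  have hlam0 : 0 < lam := by linarith
  have hρ0 : 0 < ρ := (pow_pos hγ _).trans_le hρ
  -- Chosen so that `lam * K * r ^ 2 = h / K`: the transverse energy stays below `h / K`, while `h`
  -- times the energy of a unit vector is at least `h / K`.
  set r : ℝ := √(h / lam) * (1 / K) with hr
  have hrpos : 0 < r := by positivity
  have hsq : √(h / lam) ≤ 1 := Real.sqrt_le_one.2 ((div_le_one hlam0).2 (by linarith))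
  have hr1 : r ≤ 1 := mul_le_one₀ hsq (by positivity) ((div_le_one hKpos).2 hK1)
  have hr2 : r ^ 2 = h / (lam * K ^ 2) := by
    rw [hr, mul_pow, Real.sq_sqrt (by positivity)]
    field_simp
  set A : Set (UnitSphere (m + 1)) :=
    {x | ¬ S.Decrease k (S.gammaRobust k T / (1 + ε)) P σ₀ (WithLp.ofLp x.1)} with hA
  have hcont : ∀ l, Continuous fun x : UnitSphere (m + 1) =>
      S.window σ₀ (WithLp.ofLp x.1) l k ⬝ᵥ (P *ᵥ S.window σ₀ (WithLp.ofLp x.1) l k) := fun l => by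
    have h1 : Continuous fun x : UnitSphere (m + 1) => S.window σ₀ (WithLp.ofLp x.1) l k :=
      (S.windowMap σ₀ l k).continuous_of_finiteDimensional.comp (by fun_prop)
    exact h1.dotProduct (continuous_const.matrix_mulVec h1)
  have hAm : MeasurableSet A := by
    simp only [hA, Decrease, not_le]
    exact (isOpen_lt (continuous_const.mul (hcont 0)) (hcont (T - k))).measurableSet
  have hle : c * r ^ m ≤ (sphereUniform (m + 1)).real A := by
    refine hcone u hu r hrpos hr1 A hAm fun x hs hw => ?_
    set s : ℝ := inner ℝ u x.1 with hs_def
    set w : Fin (m + 1) → ℝ := WithLp.ofLp (x.1 - s • u) with hw_def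
    have hx : WithLp.ofLp x.1 = s • WithLp.ofLp u + w := by simp [hw_def]
    have hxn : ‖x.1‖ = 1 := by simp
    have hs1 : s ≤ 1 := by
      calc s ≤ ‖u‖ * ‖x.1‖ := real_inner_le_norm _ _
        _ = 1 := by rw [hu, hxn, one_mul]
    have hww : w ⬝ᵥ w < r ^ 2 := by
      rw [dotProduct_self_eq_norm_sq, hw_def, WithLp.toLp_ofLp]
      refine pow_lt_pow_left₀ (hw.trans_le ?_) (norm_nonneg _) two_ne_zero
      exact mul_le_of_le_one_right hrpos.le hs1
    have hxx : WithLp.ofLp x.1 ⬝ᵥ WithLp.ofLp x.1 = 1 := by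
      rw [dotProduct_self_eq_norm_sq, WithLp.toLp_ofLp, hxn, one_pow]
    have hPsd := posSemidef_of_sub_one hP
    have key := le_dotProduct_mulVec_of_eq (Q := S.windowForm σ₀ 0 k P)
      (R := S.windowForm σ₀ (T - k) k P) (ρ := ρ) (u := WithLp.ofLp u)
      (S.windowForm_posSemidef σ₀ 0 k hPsd).1 (S.windowForm_posSemidef σ₀ (T - k) k hPsd)
      (fun y => by simpa only [dotProduct_windowForm_mulVec] using hall σ₀ y)
      (by simpa only [dotProduct_windowForm_mulVec] using hmax) s w
    rw [← hx] at key
    simp only [dotProduct_windowForm_mulVec] at key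
    have hQw : S.window σ₀ w 0 k ⬝ᵥ (P *ᵥ S.window σ₀ w 0 k) < h / K := by
      have h1 := dotProduct_le_of_posSemidef_sub hPlam (S.window σ₀ w 0 k)
      rw [smul_mulVec, one_mulVec, dotProduct_smul, smul_eq_mul] at h1
      calc _ ≤ lam * (S.window σ₀ w 0 k ⬝ᵥ S.window σ₀ w 0 k) := h1
        _ ≤ lam * (K * (w ⬝ᵥ w)) := by
            gcongr
            exact (hK T σ₀ w hT.le).2
        _ < lam * (K * r ^ 2) := by gcongr
        _ = h / K := by rw [hr2]; field_simp
    have hQx : h / K ≤ h * (S.window σ₀ (WithLp.ofLp x.1) 0 k ⬝ᵥ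
        (P *ᵥ S.window σ₀ (WithLp.ofLp x.1) 0 k)) := by
      have h1 := dotProduct_le_of_posSemidef_sub hP (S.window σ₀ (WithLp.ofLp x.1) 0 k)
      rw [one_mulVec] at h1
      have h2 := (hK T σ₀ (WithLp.ofLp x.1) hT.le).1
      rw [hxx] at h2
      rw [div_eq_mul_one_div]
      refine mul_le_mul_of_nonneg_left (le_trans ?_ h1) hh0.le
      rwa [div_le_iff₀ hKpos, mul_comm]
    rw [hA, Set.mem_ofPred_eq, Decrease, not_le]
    refine lt_of_lt_of_le ?_ key
    set q := S.window σ₀ (WithLp.ofLp x.1) 0 k ⬝ᵥ (P *ᵥ S.window σ₀ (WithLp.ofLp x.1) 0 k)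
    have hq : 0 ≤ q := dotProduct_mulVec_nonneg_of_sub_one hP _
    calc (S.gammaRobust k T / (1 + ε)) ^ (2 * (T - k)) * q
        = S.gammaRobust k T ^ (2 * (T - k)) * (1 - h) * q := by
          rw [div_pow, hh]
          ring
      _ ≤ ρ * (1 - h) * q := by
          have : 0 ≤ 1 - h := by linarith
          gcongr
      _ = ρ * (q - h * q) := by ring
      _ < _ := mul_lt_mul_of_pos_left (by linarith) hρ0
  calc c * (1 / K) ^ m * √(h / lam) ^ m / (M : ℝ) ^ T = c * r ^ m / (M : ℝ) ^ T := by
        rw [hr, mul_pow]; ring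
    _ ≤ (sphereUniform (m + 1)).real A / (M : ℝ) ^ T := by gcongr
    _ = _ := (datumLaw_real_prod_singleton m M T A σ₀).symm
    _ ≤ _ := by
        refine measureReal_mono ?_
        rintro ⟨x, σ⟩ ⟨hx, hσ⟩
        rw [Set.mem_singleton_iff] at hσ
        subst hσ
        exact hx

end Violation

end SLS

/-! ### The space of normalised Lyapunov matrices -/

section TracelessSymmetric

variable (ι : Type*) [Fintype ι]

/-- The space of symmetric real matrices. -/
def symmetricMatrices : Submodule ℝ (Matrix ι ι ℝ) where
  carrier := {A | Aᵀ = A}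
  add_mem' {A B} hA hB := by
    rw [Set.mem_ofPred_eq] at *
    rw [transpose_add, hA, hB]
  zero_mem' := transpose_zero
  smul_mem' c A hA := by
    rw [Set.mem_ofPred_eq] at *
    rw [transpose_smul, hA]

/-- The space of symmetric real matrices of trace zero. -/
def tracelessSymmetricMatrices : Submodule ℝ (Matrix ι ι ℝ) :=
  symmetricMatrices ι ⊓ LinearMap.ker (traceLinearMap ι ℝ ℝ)

theorem finrank_symmetricMatrices_le :
    Module.finrank ℝ (symmetricMatrices ι) ≤ (Fintype.card ι + 1).choose 2 := by
  classical
  rw [← Sym2.card, ← Module.finrank_fintype_fun_eq_card ℝ (η := Sym2 ι)]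
  let f : symmetricMatrices ι →ₗ[ℝ] (Sym2 ι → ℝ) :=
    { toFun := fun A z => Sym2.lift ⟨fun i j => A.1 i j, fun i j => by
        conv_lhs => rw [← show A.1ᵀ = A.1 from A.2]
        rfl⟩ z
      map_add' := fun A B => by
        ext z
        induction z with | _ i j => rfl
      map_smul' := fun c A => by
        ext z
        induction z with | _ i j => rfl }
  refine LinearMap.finrank_le_finrank_of_injective (f := f) fun A B h => ?_
  ext i j
  exact congrFun h s(i, j)

/-- The identity is symmetric of nonzero trace, so one dimension is lost. This brings the Helly
number `dim + 1` down to `d`. -/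
theorem finrank_tracelessSymmetricMatrices [Nonempty ι] :
    Module.finrank ℝ (tracelessSymmetricMatrices ι) + 1 ≤
      Fintype.card ι * (Fintype.card ι + 1) / 2 := by
  classical
  have hlt : tracelessSymmetricMatrices ι < symmetricMatrices ι := by
    refine lt_of_le_of_ne inf_le_left fun h => ?_
    have h1 : (1 : Matrix ι ι ℝ) ∈ symmetricMatrices ι := transpose_one
    rw [← h] at h1
    have h2 : trace (1 : Matrix ι ι ℝ) = 0 := h1.2
    rw [trace_one] at h2
    exact Fintype.card_ne_zero (α := ι) (by exact_mod_cast h2)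
  have h1 := Submodule.finrank_lt_finrank_of_lt hlt
  have h2 := finrank_symmetricMatrices_le ι
  rw [Nat.choose_two_right, Nat.add_sub_cancel, mul_comm] at h2
  omega

end TracelessSymmetric

/-! ### The scenario program as a family of random convex sets -/

namespace SLS

/-- With empty windows a nonzero state could not be told from zero. -/
theorem mul_pos_of_pathwiseIndex_le {m p M k : ℕ} [NeZero M] (S : SLS (m + 1) p M)
    (hk : S.pathwiseIndex ≤ (k : ℕ∞)) : 0 < k * p := by
  by_contra! h
  have hempty : IsEmpty (Fin k × Fin p) := by
    rw [← Fintype.card_eq_zero_iff]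
    simpa using h
  have := S.observable_of_pathwiseIndex_le hk le_rfl (fun _ => 0)
    (x := fun _ => 1) (Subsingleton.elim _ _)
  exact one_ne_zero (congrFun this 0)

section Slice

variable {n p M k T : ℕ} (S : SLS n p M)

theorem decrease_smul {γ c : ℝ} (hc : 0 < c) {P : Matrix (Fin k × Fin p) (Fin k × Fin p) ℝ}
    {σ : Fin T → Fin M} {x : Fin n → ℝ} :
    S.Decrease k γ (c • P) σ x ↔ S.Decrease k γ P σ x := by
  simp only [Decrease, smul_mulVec, dotProduct_smul, smul_eq_mul]
  rw [mul_left_comm, mul_le_mul_iff_right₀ hc]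

variable {E : Type*} [NormedAddCommGroup E] [NormedSpace ℝ E]
  (L : E →ₗ[ℝ] Matrix (Fin k × Fin p) (Fin k × Fin p) ℝ)

/-- The Lyapunov matrices `1 + L X`, of condition number at most `lam`, that are compatible with a
datum at the level `γ`. -/
def lyapunovSlice (γ lam : ℝ) (δ : Datum n M T) : Set E :=
  {X | ∃ t ∈ Set.Icc (1 / lam) 1,
    (∀ w, t * (w ⬝ᵥ w) ≤ w ⬝ᵥ ((1 + L X) *ᵥ w) ∧ w ⬝ᵥ ((1 + L X) *ᵥ w) ≤ lam * t * (w ⬝ᵥ w)) ∧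
      S.Decrease k γ (1 + L X) δ.2 (WithLp.ofLp δ.1.1)}

/-- At fixed `γ` the constraints are jointly affine in the scale `t` and `X`, and the slice is a
projection of their solution set. -/
theorem convex_lyapunovSlice (γ lam : ℝ) (δ : Datum n M T) :
    Convex ℝ (S.lyapunovSlice L γ lam δ) := by
  rintro X ⟨t, ht, hX, hXd⟩ Y ⟨s, hs, hY, hYd⟩ a b ha hb hab
  have hform : ∀ w, w ⬝ᵥ ((1 + L (a • X + b • Y)) *ᵥ w) =
      a * (w ⬝ᵥ ((1 + L X) *ᵥ w)) + b * (w ⬝ᵥ ((1 + L Y) *ᵥ w)) := fun w => by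
    have : 1 + L (a • X + b • Y) = a • (1 + L X) + b • (1 + L Y) := by
      rw [map_add, map_smul, map_smul, smul_add, smul_add, add_add_add_comm, ← add_smul, hab,
        one_smul]
    rw [this, add_mulVec, smul_mulVec, smul_mulVec, dotProduct_add, dotProduct_smul,
      dotProduct_smul, smul_eq_mul, smul_eq_mul]
  refine ⟨a * t + b * s, convex_Icc (1 / lam) 1 ht hs ha hb hab, fun w => ?_, ?_⟩
  · rw [hform]
    have h1 := mul_le_mul_of_nonneg_left (hX w).1 ha
    have h2 := mul_le_mul_of_nonneg_left (hY w).1 hb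
    have h3 := mul_le_mul_of_nonneg_left (hX w).2 ha
    have h4 := mul_le_mul_of_nonneg_left (hY w).2 hb
    constructor <;> linarith
  · rw [Decrease, hform, hform]
    have h1 := mul_le_mul_of_nonneg_left hXd ha
    have h2 := mul_le_mul_of_nonneg_left hYd hb
    linarith

/-- The scale `t` ranges over a compact interval, so projecting it away preserves closedness. -/
theorem isClosed_lyapunovSlice [FiniteDimensional ℝ E] (γ lam : ℝ) :
    IsClosed {q : Datum n M T × E | q.2 ∈ S.lyapunovSlice L γ lam q.1} := by
  have hL : Continuous L := L.continuous_of_finiteDimensional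
  have hq : ∀ {Z : Type _} [TopologicalSpace Z] {X : Z → E} {w : Z → Fin k × Fin p → ℝ},
      Continuous X → Continuous w → Continuous fun z => w z ⬝ᵥ ((1 + L (X z)) *ᵥ w z) :=
    fun hX hw => hw.dotProduct ((continuous_const.add (hL.comp hX)).matrix_mulVec hw)
  have hF : IsClosed {r : Set.Icc (1 / lam) 1 × (Datum n M T × E) |
      (∀ w, r.1.1 * (w ⬝ᵥ w) ≤ w ⬝ᵥ ((1 + L r.2.2) *ᵥ w) ∧
        w ⬝ᵥ ((1 + L r.2.2) *ᵥ w) ≤ lam * r.1.1 * (w ⬝ᵥ w)) ∧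
      S.Decrease k γ (1 + L r.2.2) r.2.1.2 (WithLp.ofLp r.2.1.1.1)} := by
    refine IsClosed.and ?_ ?_
    · simp only [Set.ofPred_forall]
      refine isClosed_iInter fun w => IsClosed.and ?_ ?_
      · exact isClosed_le (by fun_prop) (hq (by fun_prop) continuous_const)
      · exact isClosed_le (hq (by fun_prop) continuous_const) (by fun_prop)
    · have hw : ∀ l, Continuous fun r : Set.Icc (1 / lam) 1 × (Datum n M T × E) =>
          S.window r.2.1.2 (WithLp.ofLp r.2.1.1.1) l k := fun l =>
        (S.continuous_window T l k).comp (continuous_fst.comp continuous_snd)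
      exact isClosed_le (hq (by fun_prop) (hw _)) (continuous_const.mul (hq (by fun_prop) (hw _)))
  convert isClosedMap_snd_of_compactSpace _ hF using 1
  ext ⟨δ, X⟩
  constructor
  · rintro ⟨t, ht, h⟩
    exact ⟨(⟨t, ht⟩, δ, X), h, rfl⟩
  · rintro ⟨⟨t, δ', X'⟩, h, heq⟩
    obtain ⟨rfl, rfl⟩ := Prod.mk.inj heq
    exact ⟨t.1, t.2, h⟩

end Slice

/-- The probability that the scenario program underestimates the robust optimum is controlled by
the violation probability of the individual Lyapunov matrices. -/
theorem sampleLaw_gammaStar_lt_le {m p M k T N d : ℕ} [NeZero M] (S : SLS (m + 1) p M)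
    (hk : S.pathwiseIndex ≤ (k : ℕ∞)) (hT : k < T) {lam γ e : ℝ} (hlam : 1 ≤ lam) (he : 0 < e)
    (hd : d = k * p * (k * p + 1) / 2) (hdN : d ≤ N)
    (hviol : ∀ P : Matrix (Fin k × Fin p) (Fin k × Fin p) ℝ, (P - 1).PosSemidef →
      (lam • 1 - P).PosSemidef → 12 * d * e ≤
        (datumLaw (m + 1) M T).real {δ | ¬ S.Decrease k γ P δ.2 (WithLp.ofLp δ.1.1)}) :
    (sampleLaw (m + 1) M T N).real {ω | S.gammaStar k T lam ω < γ} ≤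
      max (1 - N.choose d * e ^ d) ((1 - e) ^ N) := by
  set κ := Fin k × Fin p with hκ
  have hlam0 : 0 < lam := by linarith
  have hcard : Fintype.card κ = k * p := by simp [hκ]
  have hne : Nonempty κ := Fintype.card_pos_iff.1 (hcard ▸ S.mul_pos_of_pathwiseIndex_le hk)
  have hcard0 : (0 : ℝ) < Fintype.card κ := by exact_mod_cast Fintype.card_pos
  let q := Module.finrank ℝ (tracelessSymmetricMatrices κ)
  let φ : EuclideanSpace ℝ (Fin q) ≃ₗ[ℝ] tracelessSymmetricMatrices κ :=
    LinearEquiv.ofFinrankEq _ _ (by simp [q])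
  let L : EuclideanSpace ℝ (Fin q) →ₗ[ℝ] Matrix κ κ ℝ :=
    (tracelessSymmetricMatrices κ).subtype ∘ₗ φ.toLinearMap
  have hLsymm : ∀ X, (1 + L X).IsHermitian := fun X => by
    have h1 : (L X)ᵀ = L X := (φ X).2.1
    rw [Matrix.IsHermitian, conjTranspose_eq_transpose_of_trivial, transpose_add, transpose_one, h1]
  have hbound := feasible_le_max (datumLaw (m + 1) M T) (C := S.lyapunovSlice L γ lam)
    (S.convex_lyapunovSlice L γ lam) (S.isClosed_lyapunovSlice L γ lam) (d := d) (N := N) (e := e)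
    (by
      rw [finrank_euclideanSpace_fin, hd, ← hcard]
      exact finrank_tracelessSymmetricMatrices κ) hdN he (fun X => by
      by_cases hX : ∃ t ∈ Set.Icc (1 / lam) 1, ∀ w, t * (w ⬝ᵥ w) ≤ w ⬝ᵥ ((1 + L X) *ᵥ w) ∧
          w ⬝ᵥ ((1 + L X) *ᵥ w) ≤ lam * t * (w ⬝ᵥ w)
      · obtain ⟨t, ht, hw⟩ := hX
        have ht0 : 0 < t := lt_of_lt_of_le (by positivity) ht.1
        have hPh : (t⁻¹ • (1 + L X)).IsHermitian := (hLsymm X).smul (by simp [IsSelfAdjoint])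
        refine (hviol (t⁻¹ • (1 + L X)) ?_ ?_).trans (measureReal_mono fun δ hδ hmem => ?_)
        · refine PosSemidef.of_dotProduct_mulVec_nonneg (hPh.sub isHermitian_one) fun w => ?_
          rw [star_trivial, sub_mulVec, dotProduct_sub, smul_mulVec, dotProduct_smul, one_mulVec,
            smul_eq_mul, sub_nonneg, le_inv_mul_iff₀ ht0]
          exact (hw w).1
        · refine PosSemidef.of_dotProduct_mulVec_nonneg
            ((isHermitian_one.smul (by simp [IsSelfAdjoint])).sub hPh) fun w => ?_
          rw [star_trivial, sub_mulVec, dotProduct_sub, smul_mulVec, smul_mulVec, dotProduct_smul,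
            dotProduct_smul, one_mulVec, smul_eq_mul, smul_eq_mul, sub_nonneg, inv_mul_le_iff₀ ht0]
          linarith [(hw w).2]
        · obtain ⟨s, -, -, hdec⟩ := hmem
          exact hδ ((S.decrease_smul (inv_pos.2 ht0)).2 hdec)
      -- A badly conditioned `X` is excluded by every datum; `12 * d * e ≤ 1` follows from `hviol`
      -- at the identity.
      · have huniv : {δ : Datum (m + 1) M T | X ∉ S.lyapunovSlice L γ lam δ} = Set.univ :=
          Set.eq_univ_of_forall fun δ ⟨t, ht, hw, _⟩ => hX ⟨t, ht, hw⟩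
        rw [huniv, probReal_univ]
        refine (hviol 1 (by simpa using PosSemidef.zero) ?_).trans measureReal_le_one
        have := (PosSemidef.one (n := κ) (R := ℝ)).smul (sub_nonneg.2 hlam)
        rwa [sub_smul, one_smul] at this)
  refine le_trans (measureReal_mono ?_) hbound
  intro ω hω
  obtain ⟨γ', P, hγ', hγ0, hP, hPlam, hdec⟩ := (S.gammaStar_lt_iff hk hT hlam ω γ).1 hω
  -- The mean eigenvalue of `P` lies in `[1, lam]`. Dividing by it gives `1 + X` with `X` traceless,
  -- with scale `t = τ⁻¹`.
  set τ : ℝ := trace P / Fintype.card κ with hτ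
  have h1 : 1 ≤ τ := by
    have := hP.trace_nonneg
    rw [trace_sub, trace_one] at this
    rw [hτ, one_le_div hcard0]
    linarith
  have h2 : τ ≤ lam := by
    have := hPlam.trace_nonneg
    rw [trace_sub, trace_smul, trace_one, smul_eq_mul] at this
    rw [hτ, div_le_iff₀ hcard0]
    linarith
  have hτ0 : 0 < τ := by linarith
  have hPsymm : Pᵀ = P := by
    have := (posSemidef_of_sub_one hP).1
    rwa [Matrix.IsHermitian, conjTranspose_eq_transpose_of_trivial] at this
  have hmem : τ⁻¹ • P - 1 ∈ tracelessSymmetricMatrices κ := by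
    refine ⟨?_, ?_⟩
    · change (τ⁻¹ • P - 1)ᵀ = _
      rw [transpose_sub, transpose_smul, transpose_one, hPsymm]
    · change trace (τ⁻¹ • P - 1) = 0
      rw [trace_sub, trace_smul, trace_one, smul_eq_mul, hτ]
      have : trace P ≠ 0 := fun h => by simp [hτ, h] at hτ0
      field_simp
      ring
  have hLX : 1 + L (φ.symm ⟨_, hmem⟩) = τ⁻¹ • P := by
    simp [L]
  refine ⟨φ.symm ⟨_, hmem⟩, fun i => ⟨τ⁻¹, ⟨?_, ?_⟩, fun w => ?_, ?_⟩⟩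
  · rw [one_div]
    exact inv_anti₀ hτ0 h2
  · exact inv_le_one_of_one_le₀ h1
  · rw [hLX, smul_mulVec, dotProduct_smul, smul_eq_mul]
    have h3 := dotProduct_le_of_posSemidef_sub hP w
    have h4 := dotProduct_le_of_posSemidef_sub hPlam w
    rw [one_mulVec] at h3
    rw [smul_mulVec, one_mulVec, dotProduct_smul, smul_eq_mul] at h4
    have hinv := (inv_pos.2 hτ0).le
    refine ⟨mul_le_mul_of_nonneg_left h3 hinv, ?_⟩
    calc _ ≤ τ⁻¹ * (lam * (w ⬝ᵥ w)) := mul_le_mul_of_nonneg_left h4 hinv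
      _ = _ := by ring
  · rw [hLX, S.decrease_smul (inv_pos.2 hτ0)]
    exact Decrease.mono S hγ0 hγ'.le (posSemidef_of_sub_one hP) (hdec i)

end SLS

/-! ### Existence of the limit defining the joint spectral radius -/

section Submultiplicative

/-- If `max (u j) r` converges for all `r > 0`, then so does the nonnegative sequence `u`. -/
theorem exists_tendsto_of_max {u : ℕ → ℝ} (hu : ∀ j, 0 ≤ u j)
    (h : ∀ r : ℝ, 0 < r → ∃ L, Tendsto (fun j => max (u j) r) atTop (𝓝 L)) :
    ∃ L, Tendsto u atTop (𝓝 L) := by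
  -- If some limit exceeds its `r`, the truncation is eventually inactive; otherwise every limit is
  -- at most its `r` and `u` tends to zero.
  by_cases hr : ∃ r : ℝ, 0 < r ∧ ∃ L, r < L ∧ Tendsto (fun j => max (u j) r) atTop (𝓝 L)
  · obtain ⟨r, -, L, hL, hlim⟩ := hr
    refine ⟨L, hlim.congr' ?_⟩
    filter_upwards [hlim.eventually_const_lt hL] with j hj
    exact max_eq_left ((lt_max_iff.1 hj).resolve_right (lt_irrefl _)).le
  · push Not at hr
    refine ⟨0, tendsto_order.2 ⟨fun a ha => Eventually.of_forall fun j => ha.trans_le (hu j),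
      fun a ha => ?_⟩⟩
    obtain ⟨L, hL⟩ := h (a / 2) (half_pos ha)
    have hle : L ≤ a / 2 := by
      by_contra! hlt
      exact hr _ (half_pos ha) L hlt hL
    filter_upwards [hL.eventually_lt_const (show L < a by linarith)] with j hj
    exact (le_max_left _ _).trans_lt hj

/-- The roots of a nonnegative submultiplicative sequence converge. -/
theorem exists_tendsto_rpow_of_submultiplicative {s : ℕ → ℝ} (hs : ∀ j, 0 ≤ s j)
    (hmul : ∀ i j, s (i + j) ≤ s i * s j) :
    ∃ L, Tendsto (fun j : ℕ => s j ^ (1 / (j : ℝ))) atTop (𝓝 L) := by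
  -- The terms may vanish, so Fekete's lemma is applied to the logarithm of `max (s j) (r ^ j)`,
  -- which is positive and still submultiplicative.
  refine exists_tendsto_of_max (fun j => Real.rpow_nonneg (hs j) _) fun r hr => ?_
  have hpos : ∀ j, 0 < max (s j) (r ^ j) := fun j => lt_max_of_lt_right (pow_pos hr j)
  have hsub : Subadditive fun j => Real.log (max (s j) (r ^ j)) := fun i j => by
    rw [← Real.log_mul (hpos i).ne' (hpos j).ne']
    refine Real.log_le_log (hpos _) (max_le ((hmul i j).trans ?_) ?_)
    · exact mul_le_mul (le_max_left _ _) (le_max_left _ _) (hs j) (hpos i).le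
    · rw [pow_add]
      exact mul_le_mul (le_max_right _ _) (le_max_right _ _) (pow_pos hr j).le (hpos i).le
  have hbdd : BddBelow (Set.range fun j : ℕ => Real.log (max (s j) (r ^ j)) / j) := by
    refine ⟨min 0 (Real.log r), ?_⟩
    rintro _ ⟨j, rfl⟩
    rcases Nat.eq_zero_or_pos j with rfl | hj
    · simp
    · have hj' : (0 : ℝ) < j := by exact_mod_cast hj
      refine (min_le_right _ _).trans ((le_div_iff₀ hj').2 ?_)
      rw [mul_comm, ← Real.log_pow]
      exact Real.log_le_log (pow_pos hr j) (le_max_right _ _)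
  refine ⟨Real.exp hsub.lim, ((Real.continuous_exp.tendsto _).comp (hsub.tendsto_lim hbdd)).congr' ?_⟩
  filter_upwards [eventually_gt_atTop 0] with j hj
  have hj' : (j : ℝ) ≠ 0 := by exact_mod_cast hj.ne'
  rw [Function.comp_apply, div_eq_mul_one_div, ← Real.rpow_def_of_pos (hpos j),
    (Real.monotoneOn_rpow_Ici_of_exponent_nonneg (by positivity : (0 : ℝ) ≤ 1 / j)).map_max (hs j)
      (pow_pos hr j).le, one_div, Real.pow_rpow_inv_natCast hr.le hj.ne']

end Submultiplicative

/-! ### A robust level below one bounds all matrix products -/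

namespace SLS

section JointSpectralRadius

variable {n p M : ℕ} (S : SLS n p M)

/-- The largest norm of a product of length `j`. -/
noncomputable def maxNorm (j : ℕ) : ℝ :=
  ⨆ σ : Fin j → Fin M, ‖Matrix.toEuclideanCLM (𝕜 := ℝ) (S.transition σ j)‖

theorem maxNorm_nonneg (j : ℕ) : 0 ≤ S.maxNorm j := Real.iSup_nonneg fun _ => norm_nonneg _

theorem norm_transition_le_maxNorm {j : ℕ} (σ : Fin j → Fin M) :
    ‖Matrix.toEuclideanCLM (𝕜 := ℝ) (S.transition σ j)‖ ≤ S.maxNorm j :=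
  le_ciSup (f := fun σ : Fin j → Fin M => ‖Matrix.toEuclideanCLM (𝕜 := ℝ) (S.transition σ j)‖)
    (Set.finite_range _).bddAbove σ

theorem transition_split {i j : ℕ} (σ : Fin (i + j) → Fin M) :
    S.transition σ (i + j) =
      S.transition (fun a : Fin j => σ (Fin.natAdd i a)) j *
        S.transition (fun a : Fin i => σ (Fin.castAdd j a)) i := by
  have h1 := S.transition_add (σ := σ) (σ' := fun a : Fin j => σ (Fin.natAdd i a)) (l := i) le_rfl
    (fun a => rfl) le_rfl
  have h2 := S.transition_add (σ := σ) (σ' := fun a : Fin i => σ (Fin.castAdd j a)) (l := 0)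
    (by omega) (fun a => by congr 1; ext; simp) le_rfl
  rw [h1]
  simp only [zero_add, transition, Matrix.mul_one] at h2
  rw [h2]

theorem maxNorm_add_le [NeZero M] (i j : ℕ) : S.maxNorm (i + j) ≤ S.maxNorm i * S.maxNorm j := by
  refine ciSup_le fun σ => ?_
  rw [transition_split, map_mul, mul_comm (S.maxNorm i)]
  refine (norm_mul_le _ _).trans ?_
  exact mul_le_mul (S.norm_transition_le_maxNorm _) (S.norm_transition_le_maxNorm _)
    (norm_nonneg _) (S.maxNorm_nonneg _)

theorem iSup_rpow_eq [NeZero M] (j : ℕ) :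
    ⨆ σ : Fin j → Fin M, ‖Matrix.toEuclideanCLM (𝕜 := ℝ) (S.transition σ j)‖ ^ (1 / (j : ℝ)) =
      S.maxNorm j ^ (1 / (j : ℝ)) := by
  have he : (0 : ℝ) ≤ 1 / j := by positivity
  obtain ⟨σ, hσ⟩ := exists_eq_ciSup_of_finite
    (f := fun σ : Fin j → Fin M => ‖Matrix.toEuclideanCLM (𝕜 := ℝ) (S.transition σ j)‖)
  refine le_antisymm (ciSup_le fun σ => ?_) ?_
  · exact Real.rpow_le_rpow (norm_nonneg _) (S.norm_transition_le_maxNorm σ) he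
  · rw [maxNorm, ← hσ]
    exact le_ciSup (f := fun σ : Fin j → Fin M =>
      ‖Matrix.toEuclideanCLM (𝕜 := ℝ) (S.transition σ j)‖ ^ (1 / (j : ℝ)))
      (Set.finite_range _).bddAbove σ

theorem tendsto_jsr [NeZero M] :
    Tendsto (fun j : ℕ => S.maxNorm j ^ (1 / (j : ℝ))) atTop (𝓝 S.jsr) := by
  obtain ⟨L, hL⟩ := exists_tendsto_rpow_of_submultiplicative S.maxNorm_nonneg S.maxNorm_add_le
  have : S.jsr = L := by
    rw [jsr]
    simp_rw [iSup_rpow_eq]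
    exact hL.limUnder_eq
  rwa [this]

theorem jsr_le_one_of_bounded [NeZero M] {C : ℝ} (hC : ∀ j, S.maxNorm j ≤ C) : S.jsr ≤ 1 := by
  have hC0 : 0 < max C 1 := lt_max_of_lt_right one_pos
  have hlim : Tendsto (fun j : ℕ => (max C 1) ^ (1 / (j : ℝ))) atTop (𝓝 1) := by
    have h1 : Tendsto (fun j : ℕ => 1 / (j : ℝ)) atTop (𝓝 0) := tendsto_one_div_atTop_nhds_zero_nat
    have h2 := (tendsto_const_nhds (x := max C 1)).rpow h1 (Or.inl hC0.ne')
    rwa [Real.rpow_zero] at h2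
  exact le_of_tendsto_of_tendsto' S.tendsto_jsr hlim fun j =>
    Real.rpow_le_rpow (S.maxNorm_nonneg j) ((hC j).trans (le_max_left _ _)) (by positivity)

variable {k : ℕ}

theorem exists_dotProduct_mulVec_le {ι : Type*} [Fintype ι] (P : Matrix ι ι ℝ) :
    ∃ C : ℝ, 0 ≤ C ∧ ∀ w, w ⬝ᵥ (P *ᵥ w) ≤ C * (w ⬝ᵥ w) := by
  obtain ⟨K, hK0, hK⟩ := exists_dotProduct_map_le P.mulVecLin
  refine ⟨1 + K, by linarith, fun w => ?_⟩
  have h1 : (P *ᵥ w) ⬝ᵥ (P *ᵥ w) ≤ K * (w ⬝ᵥ w) := hK w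
  have h2 : 0 ≤ (w - P *ᵥ w) ⬝ᵥ (w - P *ᵥ w) := dotProduct_self_eq_norm_sq (w - P *ᵥ w) ▸ sq_nonneg _
  have h3 : 0 ≤ w ⬝ᵥ w := dotProduct_self_eq_norm_sq w ▸ sq_nonneg _
  have h4 : 0 ≤ (P *ᵥ w) ⬝ᵥ (P *ᵥ w) := dotProduct_self_eq_norm_sq (P *ᵥ w) ▸ sq_nonneg _
  rw [sub_dotProduct, dotProduct_sub, dotProduct_sub, dotProduct_comm (P *ᵥ w) w] at h2
  nlinarith

/-- Along a nonincreasing Lyapunov function the bound on all possible first windows persists. -/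
theorem window_energy_persists {m : ℕ} (hm : 0 < m)
    {P : Matrix (Fin k × Fin p) (Fin k × Fin p) ℝ} {γ : ℝ} (hγ : γ ≤ 1)
    (h : S.RobustFeasible k (m + k) γ P) {x : Fin n → ℝ} {B : ℝ}
    (hB : ∀ τ : Fin k → Fin M, S.window τ x 0 k ⬝ᵥ (P *ᵥ S.window τ x 0 k) ≤ B)
    (σ : Fin m → Fin M) (τ : Fin k → Fin M) :
    S.window τ (S.transition σ m *ᵥ x) 0 k ⬝ᵥ (P *ᵥ S.window τ (S.transition σ m *ᵥ x) 0 k) ≤ B := by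
  -- The last window of the concatenation is the `τ`-window from the state reached by `σ`, and its
  -- first window is one of those bounded by `hB`.
  set ρ : Fin (m + k) → Fin M := Fin.append σ τ with hρ
  have h1 := S.window_add (σ := ρ) (σ' := τ) (l := m) le_rfl
    (fun i => (Fin.append_right σ τ i).symm) x (j := 0) (k := k) (by omega)
  have h2 := S.transition_add (σ := ρ) (σ' := σ) (l := 0) (by omega)
    (fun i => by
      rw [hρ, ← Fin.append_left σ τ i]
      congr 1
      ext
      simp) le_rfl
  simp only [zero_add, transition, Matrix.mul_one] at h2
  rw [h2, add_zero] at h1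
  have h3 := S.window_add (σ := ρ) (σ' := fun i : Fin k => ρ ⟨0 + i, by omega⟩) (l := 0)
    (by omega) (fun i => rfl) x (j := 0) (k := k) (by omega)
  simp only [transition, one_mulVec, add_zero] at h3
  have h4 := h.2.2 ρ x
  rw [Decrease, Nat.add_sub_cancel, h1, h3] at h4
  have h5 := hB fun i : Fin k => ρ ⟨0 + i, by omega⟩
  have h6 := dotProduct_mulVec_nonneg_of_sub_one h.2.1
    (S.window (fun i : Fin k => ρ ⟨0 + i, by omega⟩) x 0 k)
  exact h4.trans ((mul_le_of_le_one_left h6 (pow_le_one₀ h.1 hγ)).trans h5)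

/-- Peel off `m` letters at a time: the bound `B` on all first-window energies survives each block.
Fewer than `m` letters remain at the end, and observability converts energy into norm. -/
theorem exists_maxNorm_le [NeZero M] (hk : S.pathwiseIndex ≤ (k : ℕ∞)) {m : ℕ} (hm : 0 < m)
    {P : Matrix (Fin k × Fin p) (Fin k × Fin p) ℝ} {γ : ℝ} (hγ : γ ≤ 1)
    (h : S.RobustFeasible k (m + k) γ P) : ∃ C, ∀ j, S.maxNorm j ≤ C := by
  obtain ⟨K, hK1, hK⟩ := S.exists_window_bounds hk
  obtain ⟨CP, hCP0, hCP⟩ := exists_dotProduct_mulVec_le P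
  choose C₁ hC₁0 hC₁ using fun (j : ℕ) (σ : Fin j → Fin M) =>
    exists_dotProduct_map_le (S.transition σ j).mulVecLin
  set C₂ := ∑ j ∈ Finset.range m, ∑ σ, C₁ j σ with hC₂
  have hC₂0 : 0 ≤ C₂ := Finset.sum_nonneg fun j _ => Finset.sum_nonneg fun σ _ => hC₁0 j σ
  have hshort : ∀ j < m, ∀ σ : Fin j → Fin M, C₁ j σ ≤ C₂ := fun j hj σ =>
    (Finset.single_le_sum (fun σ _ => hC₁0 j σ) (Finset.mem_univ σ)).trans
      (Finset.single_le_sum (f := fun j => ∑ σ, C₁ j σ)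
        (fun j _ => Finset.sum_nonneg fun σ _ => hC₁0 j σ) (Finset.mem_range.2 hj))
  have hmain : ∀ j, ∀ (σ : Fin j → Fin M) (x : Fin n → ℝ) (B : ℝ),
      (∀ τ : Fin k → Fin M, S.window τ x 0 k ⬝ᵥ (P *ᵥ S.window τ x 0 k) ≤ B) →
      (S.transition σ j *ᵥ x) ⬝ᵥ (S.transition σ j *ᵥ x) ≤ C₂ * (K * B) := by
    intro j
    induction j using Nat.strong_induction_on with
    | _ j ih =>
      intro σ x B hB
      rcases lt_or_ge j m with hj | hj
      · have h1 := hB fun _ => 0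
        have h2 := dotProduct_le_of_posSemidef_sub h.2.1 (S.window (fun _ : Fin k => (0 : Fin M)) x 0 k)
        rw [one_mulVec] at h2
        have h3 := (hK k (fun _ => 0) x le_rfl).1
        have hx : 0 ≤ x ⬝ᵥ x := dotProduct_self_eq_norm_sq x ▸ sq_nonneg _
        calc _ ≤ C₁ j σ * (x ⬝ᵥ x) := hC₁ j σ x
          _ ≤ C₂ * (x ⬝ᵥ x) := mul_le_mul_of_nonneg_right (hshort j hj σ) hx
          _ ≤ C₂ * (K * B) := mul_le_mul_of_nonneg_left (h3.trans
              (mul_le_mul_of_nonneg_left (h2.trans h1) (by linarith))) hC₂0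
      · obtain ⟨i, rfl⟩ := Nat.exists_eq_add_of_le hj
        rw [transition_split, ← mulVec_mulVec]
        exact ih i (by omega) _ _ B fun τ => S.window_energy_persists hm hγ h hB _ τ
  refine ⟨√(C₂ * (K * (CP * K))), fun j => ciSup_le fun σ =>
    ContinuousLinearMap.opNorm_le_bound _ (Real.sqrt_nonneg _) fun x => ?_⟩
  have hC : 0 ≤ C₂ * (K * (CP * K)) := by positivity
  have h1 := hmain j σ x.ofLp (CP * K * (x.ofLp ⬝ᵥ x.ofLp)) fun τ => by
    calc _ ≤ CP * _ := hCP _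
      _ ≤ CP * (K * (x.ofLp ⬝ᵥ x.ofLp)) :=
          mul_le_mul_of_nonneg_left (hK k τ x.ofLp le_rfl).2 hCP0
      _ = _ := by ring
  rw [dotProduct_self_eq_norm_sq, dotProduct_self_eq_norm_sq, WithLp.toLp_ofLp] at h1
  have h2 : Matrix.toEuclideanCLM (𝕜 := ℝ) (S.transition σ j) x =
      WithLp.toLp 2 (S.transition σ j *ᵥ x.ofLp) := rfl
  rw [h2]
  refine abs_le_of_sq_le_sq' (a := ‖_‖) ?_ (by positivity) |>.2
  rw [mul_pow, Real.sq_sqrt hC]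
  linarith

/-- If the joint spectral radius exceeds one, then so does the robust optimum (weakly). -/
theorem one_le_gammaRobust [NeZero M] (hk : S.pathwiseIndex ≤ (k : ℕ∞)) {T : ℕ} (hT : k < T)
    (h : 1 < S.jsr) : 1 ≤ S.gammaRobust k T := by
  by_contra! hlt
  obtain ⟨γ, P, hγ, hP⟩ := S.exists_robustFeasible_of_gammaRobust_lt hk hT hlt
  obtain ⟨m, rfl⟩ := Nat.exists_eq_add_of_le' hT.le
  obtain ⟨C, hC⟩ := S.exists_maxNorm_le hk (by omega) hγ.le hP
  exact h.not_ge (S.jsr_le_one_of_bounded hC)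

end JointSpectralRadius

end SLS

theorem isClosed_setOf_posSemidef {ι Z : Type*} [Fintype ι] [TopologicalSpace Z]
    {f : Z → Matrix ι ι ℝ} (hf : Continuous f) : IsClosed {z | (f z).PosSemidef} := by
  simp only [posSemidef_iff_dotProduct_mulVec]
  refine IsClosed.and (isClosed_eq (hf.matrix_conjTranspose) hf) ?_
  simp only [Set.ofPred_forall]
  exact isClosed_iInter fun w => isClosed_le continuous_const
    (continuous_const.dotProduct (hf.matrix_mulVec continuous_const))

/-! ### Measurability, monotonicity in the sample, and detection of instability -/

namespace SLS

section Measurability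

variable {n p M k T : ℕ} (S : SLS n p M)

theorem isClosed_scenarioConstraint (γ lam : ℝ) :
    IsClosed {q : Datum n M T × (Fin k × Fin p → Fin k × Fin p → ℝ) |
      (Matrix.of q.2 - 1).PosSemidef ∧ (lam • 1 - Matrix.of q.2).PosSemidef ∧
        S.Decrease k γ (Matrix.of q.2) q.1.2 (WithLp.ofLp q.1.1.1)} := by
  have hP : Continuous fun q : Datum n M T × (Fin k × Fin p → Fin k × Fin p → ℝ) =>
      Matrix.of q.2 := continuous_snd
  have hw : ∀ l, Continuous fun q : Datum n M T × (Fin k × Fin p → Fin k × Fin p → ℝ) =>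
      S.window q.1.2 (WithLp.ofLp q.1.1.1) l k := fun l =>
    (S.continuous_window T l k).comp continuous_fst
  refine (isClosed_setOf_posSemidef (hP.sub continuous_const)).and
    ((isClosed_setOf_posSemidef (continuous_const.sub hP)).and ?_)
  exact isClosed_le ((hw _).dotProduct (hP.matrix_mulVec (hw _)))
    (continuous_const.mul ((hw _).dotProduct (hP.matrix_mulVec (hw _))))

theorem measurableSet_gammaStar_lt (hk : S.pathwiseIndex ≤ (k : ℕ∞)) (hT : k < T) {lam : ℝ}
    (hlam : 1 ≤ lam) (N : ℕ) (a : ℝ) :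
    MeasurableSet {ω : Fin N → Datum n M T | S.gammaStar k T lam ω < a} := by
  -- The bounds on `P` are attached to the individual data below, so the empty sample would lose
  -- them.
  rcases Nat.eq_zero_or_pos N with rfl | hN
  · exact Set.subsingleton_of_subsingleton.measurableSet
  have heq : {ω : Fin N → Datum n M T | S.gammaStar k T lam ω < a} =
      ⋃ (q : ℚ) (_ : (q : ℝ) < a ∧ 0 ≤ (q : ℝ)), feasibleSamples (fun δ : Datum n M T =>
        {X : Fin k × Fin p → Fin k × Fin p → ℝ | (Matrix.of X - 1).PosSemidef ∧
          (lam • 1 - Matrix.of X).PosSemidef ∧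
            S.Decrease k q (Matrix.of X) δ.2 (WithLp.ofLp δ.1.1)}) (Fin N) := by
    ext ω
    simp only [Set.mem_ofPred_eq, S.gammaStar_lt_iff hk hT hlam, Set.mem_iUnion, feasibleSamples]
    constructor
    · rintro ⟨γ, P, hγ, hγ0, hP, hPlam, hdec⟩
      obtain ⟨q, hq, hqa⟩ := exists_rat_btwn hγ
      exact ⟨q, ⟨hqa, hγ0.trans hq.le⟩, P, fun i =>
        ⟨hP, hPlam, Decrease.mono S hγ0 hq.le (posSemidef_of_sub_one hP) (hdec i)⟩⟩
    · rintro ⟨q, ⟨hqa, hq0⟩, X, hX⟩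
      exact ⟨q, Matrix.of X, hqa, hq0, (hX ⟨0, hN⟩).1, (hX ⟨0, hN⟩).2.1, fun i => (hX i).2.2⟩
  rw [heq]
  exact MeasurableSet.iUnion fun q => MeasurableSet.iUnion fun _ =>
    measurableSet_feasibleSamples (S.isClosed_scenarioConstraint q lam)

end Measurability

variable {m p M k T : ℕ}

/-- A subsample imposes fewer constraints. This carries the confidence from the least sufficient
sample size to all larger ones. -/
theorem gammaStar_comp_le {n : ℕ} (S : SLS n p M) (hk : S.pathwiseIndex ≤ (k : ℕ∞)) (hT : k < T)
    {lam : ℝ} (hlam : 1 ≤ lam) {N N' : ℕ} (f : Fin N → Fin N') (ω : Fin N' → Datum n M T) :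
    S.gammaStar k T lam (ω ∘ f) ≤ S.gammaStar k T lam ω := by
  refine le_of_forall_gt fun a ha => ?_
  rw [S.gammaStar_lt_iff hk hT hlam] at ha ⊢
  obtain ⟨γ, P, hγ, h0, hP, hPlam, hdec⟩ := ha
  exact ⟨γ, P, hγ, h0, hP, hPlam, fun i => hdec (f i)⟩

theorem compl_setOf_gammaRobust_le {n : ℕ} (S : SLS n p M) {lam ε : ℝ} (hε : 0 ≤ ε) (N : ℕ) :
    {ω : Fin N → Datum n M T | S.gammaRobust k T ≤ (1 + ε) * S.gammaStar k T lam ω}ᶜ =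
      {ω | S.gammaStar k T lam ω < S.gammaRobust k T / (1 + ε)} := by
  ext ω
  simp only [Set.mem_compl_iff, Set.mem_ofPred_eq, not_le]
  rw [lt_div_iff₀' (by linarith)]

/-- Scenario-based detection of instability. -/
theorem sampleLaw_gammaStar_lt_le_of_one_lt_jsr [NeZero M] (S : SLS (m + 1) p M)
    (hk : S.pathwiseIndex ≤ (k : ℕ∞)) (hT : k < T)
    {lam β ε : ℝ} (hlam : 1 ≤ lam) (hβ1 : β < 1) (hε : 0 ≤ ε) (hjsr : 1 < S.jsr) {N : ℕ}
    (hN : S.sampleComplexity k T lam ε β ≤ (N : ℕ∞)) :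
    sampleLaw (m + 1) M T N {ω | S.gammaStar k T lam ω < 1 / (1 + ε)} ≤ ENNReal.ofReal β := by
  obtain ⟨N₀, hN₀, hprob⟩ : ∃ N₀ ≤ N, ENNReal.ofReal (1 - β) ≤ sampleLaw (m + 1) M T N₀
      {ω | S.gammaRobust k T ≤ (1 + ε) * S.gammaStar k T lam ω} := by
    by_contra! h
    have h1 : ((N + 1 : ℕ) : ℕ∞) ≤ S.sampleComplexity k T lam ε β := le_iInf₂ fun N' hN' => by
      by_contra! hlt
      have hlt' : N' < N + 1 := by exact_mod_cast hlt
      exact (h N' (by omega)).not_ge hN'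
    have h2 : N + 1 ≤ N := by exact_mod_cast h1.trans hN
    omega
  have hmeas := S.measurableSet_gammaStar_lt hk hT hlam N₀ (S.gammaRobust k T / (1 + ε))
  have hmp := measurePreserving_pi_comp (datumLaw (m + 1) M T) (Fin.castLE_injective hN₀)
  have h1ε : 0 < 1 + ε := by linarith
  calc sampleLaw (m + 1) M T N {ω | S.gammaStar k T lam ω < 1 / (1 + ε)}
      ≤ sampleLaw (m + 1) M T N ((fun ω : Fin N → Datum (m + 1) M T => ω ∘ Fin.castLE hN₀) ⁻¹'
          {ω | S.gammaStar k T lam ω < S.gammaRobust k T / (1 + ε)}) := by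
        refine measure_mono fun ω hω => ?_
        refine (S.gammaStar_comp_le hk hT hlam _ ω).trans_lt (lt_of_lt_of_le hω ?_)
        exact div_le_div_of_nonneg_right (S.one_le_gammaRobust hk hT hjsr) h1ε.le
    _ = sampleLaw (m + 1) M T N₀ {ω | S.gammaStar k T lam ω < S.gammaRobust k T / (1 + ε)} :=
        hmp.measure_preimage hmeas.nullMeasurableSet
    _ ≤ ENNReal.ofReal β := by
        rw [← S.compl_setOf_gammaRobust_le hε] at hmeas ⊢
        rw [prob_compl_eq_one_sub (by simpa using hmeas.compl)]
        refine (tsub_le_tsub_left hprob 1).trans ?_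
        rw [← ENNReal.ofReal_one, ← ENNReal.ofReal_sub _ (by linarith)]
        exact ENNReal.ofReal_le_ofReal (by linarith)

end SLS

/-! ### Size of the precision level and assembly of the bounds -/

section PrecisionLevel

theorem one_sub_one_div_mem_Icc {ε : ℝ} (q : ℕ) (hε : 0 ≤ ε) :
    1 - 1 / (1 + ε) ^ q ∈ Set.Icc (0 : ℝ) 1 := by
  have h1 : 1 ≤ (1 + ε) ^ q := one_le_pow₀ (by linarith)
  have h2 : 1 / (1 + ε) ^ q ≤ 1 := (div_le_one (by linarith)).2 h1
  have h3 : 0 < 1 / (1 + ε) ^ q := by positivity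
  constructor <;> linarith

theorem half_le_one_sub_one_div {ε : ℝ} {q : ℕ} (hq : q ≠ 0) (hε : 0 ≤ ε) (hε1 : ε ≤ 1) :
    ε / 2 ≤ 1 - 1 / (1 + ε) ^ q := by
  have h1 : 1 + ε ≤ (1 + ε) ^ q := le_self_pow₀ (by linarith) hq
  have h2 : 1 / (1 + ε) ^ q ≤ 1 / (1 + ε) := one_div_le_one_div_of_le (by linarith) h1
  have h3 : 1 / (1 + ε) ≤ 1 - ε / 2 := by
    rw [div_le_iff₀ (by linarith)]
    nlinarith
  linarith

theorem sqrt_pow_eq {x : ℝ} (hx : 0 ≤ x) (m : ℕ) : √(x ^ m) = √x ^ m := by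
  rw [← Real.sqrt_sq (pow_nonneg (Real.sqrt_nonneg x) m), ← pow_mul, mul_comm, pow_mul,
    Real.sq_sqrt hx]

theorem rpow_half_eq_sqrt_pow {x : ℝ} (hx : 0 ≤ x) (m : ℕ) : x ^ ((m : ℝ) / 2) = √x ^ m := by
  rw [Real.sqrt_eq_rpow, ← Real.rpow_natCast, ← Real.rpow_mul hx]
  congr 1
  ring

theorem precisionLevel_eq {c lam : ℝ} (hclam : 0 ≤ c * lam) (m M k T : ℕ) (ε : ℝ) :
    precisionLevel (m + 1) M k T c lam ε =
      regBeta (1 - 1 / (1 + ε) ^ (2 * (T - k))) ((m : ℝ) / 2) (1 / 2) /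
        ((M : ℝ) ^ T * √(c * lam) ^ m) := by
  rw [precisionLevel, Nat.add_sub_cancel, sqrt_pow_eq hclam, Nat.cast_succ, add_sub_cancel_right]

theorem precisionLevel_mem_Icc {c lam ε : ℝ} (hc : 1 ≤ c) (hlam : 1 ≤ lam) (hε : 0 ≤ ε) {m M : ℕ}
    (hm : 0 < m) (hM : 0 < M) (k T : ℕ) :
    precisionLevel (m + 1) M k T c lam ε ∈ Set.Icc (0 : ℝ) 1 := by
  have hm' : (0 : ℝ) < (m : ℝ) / 2 := by positivity
  have hM' : (1 : ℝ) ≤ M := by exact_mod_cast hM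
  have hh := one_sub_one_div_mem_Icc (2 * (T - k)) hε
  have hclam : 1 ≤ c * lam := one_le_mul_of_one_le_of_one_le hc hlam
  rw [precisionLevel_eq (by linarith)]
  have h1 : 1 ≤ (M : ℝ) ^ T * √(c * lam) ^ m :=
    one_le_mul_of_one_le_of_one_le (one_le_pow₀ hM') (one_le_pow₀ (Real.one_le_sqrt.2 hclam))
  refine ⟨div_nonneg (regBeta_nonneg hm' one_half_pos hh) (by linarith), ?_⟩
  exact (div_le_one (by linarith)).2 ((regBeta_le_one hm' one_half_pos hh).trans h1)

theorem exists_le_precisionLevel {c lam : ℝ} (hc : 1 ≤ c) (hlam : 1 ≤ lam) {m M k T : ℕ}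
    (hm : 0 < m) (hM : 0 < M) (hT : k < T) :
    ∃ κ : ℝ, 0 < κ ∧ ∀ ε : ℝ, 0 < ε → ε ≤ 1 →
      κ * ε ^ ((m : ℝ) / 2) ≤ precisionLevel (m + 1) M k T c lam ε := by
  have hm' : (0 : ℝ) < (m : ℝ) / 2 := by positivity
  have hM' : (0 : ℝ) < M := by exact_mod_cast hM
  have hclam : 0 < c * lam := by nlinarith
  obtain ⟨b, hb, hle⟩ := exists_le_regBeta hm'
  refine ⟨b * (1 / 2) ^ ((m : ℝ) / 2) / ((M : ℝ) ^ T * √(c * lam) ^ m), by positivity,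
    fun ε hε hε1 => ?_⟩
  rw [precisionLevel_eq hclam.le, div_mul_eq_mul_div, mul_assoc,
    ← Real.mul_rpow (by norm_num) hε.le]
  refine div_le_div_of_nonneg_right (le_trans ?_ (hle _ (one_sub_one_div_mem_Icc _ hε.le)))
    (by positivity)
  refine mul_le_mul_of_nonneg_left (Real.rpow_le_rpow (by positivity) ?_ hm'.le) hb.le
  have := half_le_one_sub_one_div (q := 2 * (T - k)) (by omega) hε.le hε1
  linarith

end PrecisionLevel

namespace SLS

variable {m p M k : ℕ} [NeZero M] (S : SLS (m + 1) p M)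

/-- The constant of the sample complexity bound can be chosen so large that the precision level is
a given fraction of the violation probability. -/
theorem exists_mul_precisionLevel_le (hm : 0 < m) (hk : S.pathwiseIndex ≤ (k : ℕ∞)) {D : ℝ}
    (hD : 0 ≤ D) :
    ∃ c : ℝ, 1 ≤ c ∧ ∀ (T : ℕ) (lam ε : ℝ), k < T → 1 ≤ lam → 0 < ε → 0 < S.gammaRobust k T →
      ∀ P : Matrix (Fin k × Fin p) (Fin k × Fin p) ℝ, (P - 1).PosSemidef →
        (lam • 1 - P).PosSemidef →
        D * precisionLevel (m + 1) M k T c lam ε ≤ (datumLaw (m + 1) M T).real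
          {δ | ¬ S.Decrease k (S.gammaRobust k T / (1 + ε)) P δ.2 (WithLp.ofLp δ.1.1)} := by
  have hm' : (0 : ℝ) < (m : ℝ) / 2 := by positivity
  have hM' : (0 : ℝ) < M := by exact_mod_cast Nat.pos_of_neZero M
  obtain ⟨v, hv, hviol⟩ := S.exists_le_datumLaw_not_decrease hk
  obtain ⟨b, hb, hle⟩ := exists_regBeta_le hm'
  set q : ℝ := D * b / v with hq
  have hq0 : 0 ≤ q := by positivity
  -- As `m ≥ 1`, this gives `√c ^ m ≥ √c ≥ q = D * b / v`, so the denominator of the level absorbs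
  -- `D` and both comparison constants.
  refine ⟨max 1 (q ^ 2), le_max_left _ _, fun T lam ε hT hlam hε hγ P hP hPlam =>
    le_trans ?_ (hviol T lam ε hT hlam hε hγ P hP hPlam)⟩
  set c : ℝ := max 1 (q ^ 2)
  have hc1 : 1 ≤ c := le_max_left _ _
  have hh := one_sub_one_div_mem_Icc (2 * (T - k)) hε.le
  set h : ℝ := 1 - 1 / (1 + ε) ^ (2 * (T - k))
  have hlam0 : 0 < lam := by linarith
  have hqc : q ≤ √c ^ m := by
    calc q ≤ √c := Real.le_sqrt_of_sq_le (le_max_right _ _)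
      _ ≤ √c ^ m := le_self_pow₀ (Real.one_le_sqrt.2 hc1) hm.ne'
  have hDb : D * b ≤ v * √c ^ m := by
    calc D * b = v * q := by rw [hq]; field_simp
      _ ≤ _ := mul_le_mul_of_nonneg_left hqc hv.le
  have hcpos : 0 < √c := Real.sqrt_pos.2 (by linarith)
  have hlpos : 0 < √lam := Real.sqrt_pos.2 hlam0
  rw [precisionLevel_eq (by positivity), Real.sqrt_mul (by linarith), Real.sqrt_div hh.1, mul_pow,
    div_pow, ← mul_div_assoc, ← mul_div_assoc, div_div]
  have hbeta := hle h hh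
  rw [rpow_half_eq_sqrt_pow hh.1] at hbeta
  rw [div_le_div_iff₀ (by positivity) (by positivity)]
  have hs : 0 ≤ √h ^ m := by positivity
  calc D * regBeta h (m / 2) (1 / 2) * (√lam ^ m * (M : ℝ) ^ T)
      ≤ D * (b * √h ^ m) * (√lam ^ m * (M : ℝ) ^ T) := by gcongr
    _ = D * b * (√h ^ m * (√lam ^ m * (M : ℝ) ^ T)) := by ring
    _ ≤ v * √c ^ m * (√h ^ m * (√lam ^ m * (M : ℝ) ^ T)) := by gcongr
    _ = v * √h ^ m * ((M : ℝ) ^ T * (√c ^ m * √lam ^ m)) := by ring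

/-- **Scenario bound.** The robust optimum is approximated with the required confidence as soon as
`phiTail` is small enough at the precision level. -/
theorem exists_le_sampleLaw_of_phiTail_le (hm : 0 < m) (hk : S.pathwiseIndex ≤ (k : ℕ∞)) :
    ∃ c : ℝ, 1 ≤ c ∧ ∀ (T : ℕ) (lam β ε : ℝ) (N : ℕ), k < T → 1 ≤ lam → β < 1 → 0 ≤ ε →
      k * p * (k * p + 1) / 2 ≤ N →
      phiTail (precisionLevel (m + 1) M k T c lam ε) (k * p * (k * p + 1) / 2) N ≤ β →
      ENNReal.ofReal (1 - β) ≤ sampleLaw (m + 1) M T N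
        {ω | S.gammaRobust k T ≤ (1 + ε) * S.gammaStar k T lam ω} := by
  set d := k * p * (k * p + 1) / 2 with hd
  have hkp := S.mul_pos_of_pathwiseIndex_le hk
  have hd1 : 1 ≤ d := by
    rw [hd, Nat.le_div_iff_mul_le two_pos]
    nlinarith
  obtain ⟨c, hc, hlevel⟩ := S.exists_mul_precisionLevel_le hm hk (D := 12 * d) (by positivity)
  refine ⟨c, hc, fun T lam β ε N hT hlam hβ hε hN hφ => ?_⟩
  have hM := Nat.pos_of_neZero M
  have he := precisionLevel_mem_Icc hc hlam hε hm hM k T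
  -- At `ε = 0` the level is zero and `phiTail` equals one, contradicting `β < 1`.
  have hε0 : 0 < ε := by
    refine lt_of_le_of_ne hε fun h0 => ?_
    subst h0
    rw [precisionLevel_eq (by nlinarith)] at hφ
    simp only [add_zero, one_pow, div_one, sub_self, regBeta_zero, zero_div, phiTail,
      sub_zero] at hφ
    linarith
  have he0 : 0 < precisionLevel (m + 1) M k T c lam ε := by
    refine lt_of_le_of_ne he.1 fun h0 => ?_
    rw [← h0, phiTail, regBeta_zero] at hφ
    linarith
  have hcompl : (sampleLaw (m + 1) M T N).real
      {ω | S.gammaStar k T lam ω < S.gammaRobust k T / (1 + ε)} ≤ max 0 β := by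
    -- If the robust optimum is zero, underestimation is impossible.
    rcases S.gammaRobust_nonneg (k := k) (T := T) |>.eq_or_lt with hγ | hγ
    · refine le_max_of_le_left (le_of_eq ?_)
      have : {ω : Fin N → Datum (m + 1) M T |
          S.gammaStar k T lam ω < S.gammaRobust k T / (1 + ε)} = ∅ := by
        refine Set.eq_empty_of_forall_notMem fun ω hω => ?_
        rw [Set.mem_ofPred_eq, ← hγ, zero_div] at hω
        exact hω.not_ge (S.gammaStar_nonneg ω)
      rw [this, measureReal_empty]
    · refine le_max_of_le_right (le_trans ?_ hφ)
      refine (S.sampleLaw_gammaStar_lt_le hk hT hlam he0 hd hN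
        fun P hP hPlam => hlevel T lam ε hT hlam hε0 hγ P hP hPlam).trans ?_
      exact max_le (one_sub_choose_mul_pow_le_phiTail hd1 hN he) (one_sub_pow_le_phiTail hd1 hN he)
  have hβ0 : max 0 β = β := by
    refine max_eq_right (le_trans ?_ hφ)
    exact (pow_nonneg (by linarith [he.2]) N).trans (one_sub_pow_le_phiTail hd1 hN he)
  rw [hβ0, ← S.compl_setOf_gammaRobust_le hε, probReal_compl_eq_one_sub (by
    have := S.measurableSet_gammaStar_lt hk hT hlam N (S.gammaRobust k T / (1 + ε))
    rw [← S.compl_setOf_gammaRobust_le hε] at this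
    simpa using this.compl)] at hcompl
  rw [ENNReal.ofReal_le_iff_le_toReal (measure_ne_top _ _)]
  change 1 - β ≤ (sampleLaw (m + 1) M T N).real _
  linarith

end SLS

/-- Sample sizes of order `1 / (β ε ^ (n / 2))` make `phiTail` small. -/
theorem exists_phiTail_le {c lam : ℝ} (hc : 1 ≤ c) (hlam : 1 ≤ lam) {m M k T d : ℕ}
    (hm : 0 < m) (hM : 0 < M) (hT : k < T) (hd : 1 ≤ d) :
    ∃ K : ℝ, 0 < K ∧ ∀ β ε : ℝ, 0 < β → β < 1 → 0 < ε → ε ≤ 1 → ∀ N : ℕ,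
      K * (1 / β * (1 / ε) ^ (((m + 1 : ℕ) : ℝ) / 2)) ≤ (N : ℝ) →
        d ≤ N ∧ phiTail (precisionLevel (m + 1) M k T c lam ε) d N ≤ β := by
  obtain ⟨κ, hκ, hlevel⟩ := exists_le_precisionLevel (k := k) (T := T) hc hlam hm hM hT
  have hd0 : (0 : ℝ) < d := by exact_mod_cast hd
  refine ⟨d / κ, by positivity, fun β ε hβ hβ1 hε hε1 N hN => ?_⟩
  have he := hlevel ε hε hε1
  have hε' : 0 < ε ^ ((m : ℝ) / 2) := Real.rpow_pos_of_pos hε _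
  have he0 : 0 < precisionLevel (m + 1) M k T c lam ε := lt_of_lt_of_le (by positivity) he
  have he1 := (precisionLevel_mem_Icc hc hlam hε.le hm hM k T).2
  set e := precisionLevel (m + 1) M k T c lam ε
  -- The level is of order `ε ^ ((n - 1) / 2)`; the exponent is relaxed to `n / 2` because `1 / ε ≥
  -- 1`.
  have hpow : 1 / ε ^ ((m : ℝ) / 2) ≤ (1 / ε) ^ (((m + 1 : ℕ) : ℝ) / 2) := by
    rw [← Real.one_rpow ((m : ℝ) / 2), ← Real.div_rpow zero_le_one hε.le, Real.one_rpow]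
    refine Real.rpow_le_rpow_of_exponent_le ((one_le_div hε).2 hε1) ?_
    push_cast
    linarith
  have hNe : d / (e * β) ≤ (N : ℝ) := by
    calc d / (e * β) ≤ d / (κ * ε ^ ((m : ℝ) / 2) * β) := by gcongr
      _ = d / κ * (1 / β * (1 / ε ^ ((m : ℝ) / 2))) := by field_simp
      _ ≤ d / κ * (1 / β * (1 / ε) ^ (((m + 1 : ℕ) : ℝ) / 2)) := by gcongr
      _ ≤ N := hN
  have hdN : (d : ℝ) ≤ N := by
    refine le_trans ((le_div_iff₀ (by positivity)).2 ?_) hNe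
    exact mul_le_of_le_one_right hd0.le (mul_le_one₀ he1 hβ.le hβ1.le)
  have hdN' : d ≤ N := by exact_mod_cast hdN
  refine ⟨hdN', (phiTail_le hd hdN' he0 he1).trans ?_⟩
  rw [div_le_iff₀ (by positivity)] at hNe ⊢
  nlinarith [mul_pos he0 hβ]

theorem exists_nPhi_eq_le {d : ℕ} {e β y : ℝ} (hy : 0 ≤ y)
    (h : ∀ N : ℕ, y ≤ (N : ℝ) → d ≤ N ∧ phiTail e d N ≤ β) :
    ∃ m : ℕ, nPhi d e β = (m : ℕ∞) ∧ (m : ℝ) ≤ y + 1 := by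
  have hle : nPhi d e β ≤ (⌈y⌉₊ : ℕ∞) := iInf₂_le ⌈y⌉₊ (h ⌈y⌉₊ (Nat.le_ceil y))
  obtain ⟨m, hm⟩ := ENat.ne_top_iff_exists.1 (ne_top_of_le_ne_top (ENat.natCast_ne_top _) hle)
  rw [← hm] at hle
  have hle' : m ≤ ⌈y⌉₊ := by exact_mod_cast hle
  exact ⟨m, hm.symm, (Nat.cast_le.2 hle').trans (Nat.ceil_lt_add_one hy).le⟩

theorem proposition1 {n p M : ℕ} (hn : 2 ≤ n) (hM : 0 < M) (S : SLS n p M) (k : ℕ)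
    (hk : S.pathwiseIndex ≤ (k : ℕ∞)) :
    (∃ c : ℝ, 1 ≤ c ∧ ∀ (T : ℕ) (lam : ℝ), k < T → 1 ≤ lam →
      (∀ σ : Fin T → Fin M, ¬ S.Degenerate k σ) →
        (∀ β ε : ℝ, 0 < β → β < 1 → 0 ≤ ε →
          S.sampleComplexity k T lam ε β ≤
            nPhi (k * p * (k * p + 1) / 2) (precisionLevel n M k T c lam ε) β) ∧
        ∃ K : ℝ, 0 < K ∧
          (∀ β ε : ℝ, 0 < β → β < 1 → 0 < ε → ε ≤ 1 →
            ∃ m : ℕ,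
              nPhi (k * p * (k * p + 1) / 2) (precisionLevel n M k T c lam ε) β = (m : ℕ∞) ∧
              (m : ℝ) ≤ K * (1 / β * (1 / ε) ^ ((n : ℝ) / 2))) ∧
          (∀ β ε : ℝ, 0 < β → β < 1 → 0 < ε → ε ≤ 1 →
            ∀ N : ℕ, K * (1 / β * (1 / ε) ^ ((n : ℝ) / 2)) ≤ (N : ℝ) →
              ENNReal.ofReal (1 - β) ≤ sampleLaw n M T N
                {ω | S.gammaRobust k T ≤ (1 + ε) * S.gammaStar k T lam ω})) ∧
    (∀ (T : ℕ) (lam : ℝ), k < T → 1 ≤ lam →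
      (∀ σ : Fin T → Fin M, ¬ S.Degenerate k σ) → 1 < S.jsr →
        ∀ β ε : ℝ, 0 < β → β < 1 → 0 ≤ ε →
          ∀ N : ℕ, S.sampleComplexity k T lam ε β ≤ (N : ℕ∞) →
            sampleLaw n M T N {ω | S.gammaStar k T lam ω < 1 / (1 + ε)} ≤
              ENNReal.ofReal β) := by
  obtain ⟨m, rfl⟩ : ∃ m, n = m + 1 := ⟨n - 1, by omega⟩
  have hm : 0 < m := by omega
  have : NeZero M := ⟨hM.ne'⟩
  refine ⟨?_, fun T lam hT hlam _ hjsr β ε _ hβ1 hε N hN =>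
    S.sampleLaw_gammaStar_lt_le_of_one_lt_jsr hk hT hlam hβ1 hε hjsr hN⟩
  obtain ⟨c, hc, hmain⟩ := S.exists_le_sampleLaw_of_phiTail_le hm hk
  have hkp := S.mul_pos_of_pathwiseIndex_le hk
  have hd1 : 1 ≤ k * p * (k * p + 1) / 2 := by
    rw [Nat.le_div_iff_mul_le two_pos]
    nlinarith
  refine ⟨c, hc, fun T lam hT hlam _ => ⟨fun β ε _ hβ1 hε => ?_, ?_⟩⟩
  · exact le_iInf₂ fun N hN => iInf₂_le N (hmain T lam β ε N hT hlam hβ1 hε hN.1 hN.2)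
  · obtain ⟨K, hK, hφ⟩ := exists_phiTail_le (k := k) (T := T) hc hlam hm hM hT hd1
    have hone : ∀ β ε : ℝ, 0 < β → β < 1 → 0 < ε → ε ≤ 1 →
        1 ≤ 1 / β * (1 / ε) ^ (((m + 1 : ℕ) : ℝ) / 2) := fun β ε hβ hβ1 hε hε1 =>
      one_le_mul_of_one_le_of_one_le ((one_le_div hβ).2 hβ1.le)
        (Real.one_le_rpow ((one_le_div hε).2 hε1) (by positivity))
    -- The extra one pays for rounding up to an integer, since the factor multiplying it is at least
    -- one.
    refine ⟨K + 1, by linarith, fun β ε hβ hβ1 hε hε1 => ?_, fun β ε hβ hβ1 hε hε1 N hN => ?_⟩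
    · have h1 := hone β ε hβ hβ1 hε hε1
      obtain ⟨N, hN, hle⟩ := exists_nPhi_eq_le (by positivity) (hφ β ε hβ hβ1 hε hε1)
      exact ⟨N, hN, hle.trans (by linarith)⟩
    · have h1 := hone β ε hβ hβ1 hε hε1
      obtain ⟨hdN, hphi⟩ := hφ β ε hβ hβ1 hε hε1 N (by linarith)
      exact hmain T lam β ε N hT hlam hβ1 hε.le hdN hphi
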